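/- Let $k\ge 1$ and $n\ge 2$. Let $V=\mathbb{C}^n$ be the permutation representation of $S_n$ with basis $v_1,\dots,v_n$, let $W=\{x\in V:\sum_i x_i=0\}\cong S^{(n-1,1)}$, and let $S_n$ act diagonally on $W^{\otimes k}$. The quasi-partition algebra is the centralizer algebra $QP_k(n)=\operatorname{End}_{S_n}(W^{\otimes k})$. A diagram $d$ is a set partition of the $2k$ vertices $\{1,\dots,k\}\cup\{1',\dots,k'\}$. It acts on $V^{\otimes k}$ by $$d\cdot(v_{i_{1'}}\otimes\cdots\otimes v_{i_{k'}})=\sum v_{i_1}\otimes\cdots\otimes v_{i_k},$$ where the sum is over all $i_1,\dots,i_k\in\{1,\dots,n\}$ such that $i_s=i_t$ whenever the vertices $s$ and $t$ lie in the same block of $d$. Let $\pi:V\to W$ be the projection $\pi(v_i)=v_i-\frac1n(v_1+\cdots+v_n)$, and let $\bar d\in\operatorname{End}(W^{\otimes k})$ be $\pi^{\otimes k}\circ d$ restricted to $W^{\otimes k}\subseteq V^{\otimes k}$. Let $\mathcal G=\{s_1,\dots,s_{k-1},e_1,b_1,t_1,h_1\}$, where the diagrams have the following blocks, together with $\{j,j'\}$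 for every $j$ not mentioned: - $s_i$: $\{i,(i+1)'\},\ \{i+1,i'\}$; - $e_1$: $\{1,2\},\ \{1',2'\}$; - $b_1$: $\{1,2,1',2'\}$; - $t_1$: $\{1,2,1'\},\ \{3,2',3'\}$; - $h_1$: $\{1,2,3\},\ \{1',2',3'\}$. Here $e_1,b_1$ are included only if $k\ge2$, and $t_1,h_1$ only if $k\ge3$. Then $QP_k(n)$ is generated, as a unital $\mathbb{C}$-algebra, by $\{\bar d\mid d\in\mathcal G\}$; that is, the subalgebra of $\operatorname{End}(W^{\otimes k})$ generated by these elements is equal to $QP_k(n)$. -/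

import Mathlib

open scoped TensorProduct

noncomputable section

namespace QuasiPartition

/-! ## Partition diagrams -/

/-- A `k`-partition diagram: a set partition (encoded as the equivalence relation "lie in the same
block") of the `2k` vertices, where `Sum.inl j` is the top vertex number `j + 1` and `Sum.inr j` is
the bottom vertex number `(j + 1)'`. -/
abbrev Diagram (k : ℕ) : Type := Setoid (Fin k ⊕ Fin k)

/-- The diagram in which two vertices lie in the same block exactly if their labels agree; `top`
labels the top row and `bot` the bottom row. Positions and labels are counted from `0`. -/
abbrev Diagram.ofLabels (k : ℕ) (top bot : ℕ → ℕ) : Diagram k :=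
  Setoid.ker (Sum.elim (fun j : Fin k => top j) (fun j : Fin k => bot j))

/-- `s_{i+1}`: blocks `{i+1, (i+2)'}`, `{i+2, (i+1)'}` and `{j, j'}` for all other `j`. -/
abbrev diagS (k i : ℕ) : Diagram k :=
  Diagram.ofLabels k (fun j => Equiv.swap i (i + 1) j) (fun j => j)

/-- `e_{i+1}`: blocks `{i+1, i+2}`, `{(i+1)', (i+2)'}` and `{j, j'}` for all other `j`. -/
abbrev diagE (k i : ℕ) : Diagram k :=
  Diagram.ofLabels k
    (fun j => if j = i ∨ j = i + 1 then i else j)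
    (fun j => if j = i ∨ j = i + 1 then i + 1 else j)

/-- `b_{i+1}`: one block `{i+1, i+2, (i+1)', (i+2)'}`, and `{j, j'}` for all other `j`. -/
abbrev diagB (k i : ℕ) : Diagram k :=
  Diagram.ofLabels k
    (fun j => if j = i ∨ j = i + 1 then i else j)
    (fun j => if j = i ∨ j = i + 1 then i else j)

/-- `t_{i+1}`: blocks `{i+1, i+2, (i+1)'}`, `{i+3, (i+2)', (i+3)'}`, and `{j, j'}` for all
other `j`. -/
abbrev diagT (k i : ℕ) : Diagram k :=
  Diagram.ofLabels k
    (fun j => if j = i ∨ j = i + 1 then i else j)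
    (fun j => if j = i + 1 ∨ j = i + 2 then i + 2 else j)

/-- `h_{i+1}`: blocks `{i+1, i+2, i+3}`, `{(i+1)', (i+2)', (i+3)'}`, and `{j, j'}` for all
other `j`. -/
abbrev diagH (k i : ℕ) : Diagram k :=
  Diagram.ofLabels k
    (fun j => if j = i ∨ j = i + 1 ∨ j = i + 2 then i else j)
    (fun j => if j = i ∨ j = i + 1 ∨ j = i + 2 then i + 1 else j)

/-- The set `𝒢 = {s_1, …, s_{k-1}, e_1, b_1, t_1, h_1}`. A diagram is listed only if it exists:
`s_i` for `1 ≤ i ≤ k - 1`, `e_1` and `b_1` for `2 ≤ k`, and `t_1` and `h_1` for `3 ≤ k`. -/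
def generators (k : ℕ) : Set (Diagram k) :=
  {d | (∃ i : ℕ, i + 1 < k ∧ d = diagS k i) ∨
       (2 ≤ k ∧ (d = diagE k 0 ∨ d = diagB k 0)) ∨
       (3 ≤ k ∧ (d = diagT k 0 ∨ d = diagH k 0))}

/-! ## The permutation representation and its tensor powers -/

/-- The permutation representation `V = ℂⁿ` of `S_n`, with `σ • v_i = v_{σ i}` on the standard
basis (see `permRep_single`). -/
def permRep (n : ℕ) : Representation ℂ (Equiv.Perm (Fin n)) (Fin n → ℂ) where
  toFun σ := LinearMap.funLeft ℂ ℂ ⇑σ⁻¹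
  map_one' := by ext; simp
  map_mul' σ τ := by ext; simp [LinearMap.funLeft_apply]

theorem permRep_single (n : ℕ) (σ : Equiv.Perm (Fin n)) (i : Fin n) :
    permRep n σ (Pi.single i 1) = Pi.single (σ i) 1 := by
  ext j
  simp [permRep, LinearMap.funLeft_apply, Pi.single_apply, Equiv.symm_apply_eq]

/-- `W = S^{(n-1,1)}`: the vectors of `V = ℂⁿ` with coordinate sum `0`. -/
def W (n : ℕ) : Submodule ℂ (Fin n → ℂ) :=
  LinearMap.ker (∑ i, LinearMap.proj i : (Fin n → ℂ) →ₗ[ℂ] ℂ)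

theorem mem_W {n : ℕ} {x : Fin n → ℂ} : x ∈ W n ↔ ∑ i, x i = 0 := by
  simp [W]

theorem W_le_comap (n : ℕ) (σ : Equiv.Perm (Fin n)) : W n ≤ (W n).comap (permRep n σ) := by
  intro x hx
  rw [Submodule.mem_comap, mem_W]
  rw [mem_W] at hx
  rw [← hx]
  exact Equiv.sum_comp σ⁻¹ x

/-- The action of `S_n` on `W`. -/
def wRep (n : ℕ) : Representation ℂ (Equiv.Perm (Fin n)) (W n) :=
  (permRep n).subrepresentation (W n) (W_le_comap n)

/-- `V^{⊗k}`. -/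
abbrev VTensor (k n : ℕ) : Type := ⨂[ℂ] _ : Fin k, (Fin n → ℂ)

/-- `W^{⊗k}`. -/
abbrev WTensor (k n : ℕ) : Type := ⨂[ℂ] _ : Fin k, W n

/-- The diagonal action of `S_n` on `W^{⊗k}`. -/
def wTensorRep (k n : ℕ) : Representation ℂ (Equiv.Perm (Fin n)) (WTensor k n) where
  toFun σ := PiTensorProduct.map fun _ => wRep n σ
  map_one' := by
    simp only [map_one]
    exact PiTensorProduct.map_one
  map_mul' σ τ := by
    simp only [map_mul]
    exact PiTensorProduct.map_mul _ _

/-- The quasi-partition algebra `QP_k(n) = End_{S_n}(W^{⊗k})`: the endomorphisms of `W^{⊗k}` that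
commute with the diagonal action of `S_n`. -/
def QP (k n : ℕ) : Subalgebra ℂ (Module.End ℂ (WTensor k n)) :=
  Subalgebra.centralizer ℂ (Set.range (wTensorRep k n))

/-! ## Diagrams as operators, and their projections -/

/-- The basis `v_{i_1} ⊗ ⋯ ⊗ v_{i_k}` of `V^{⊗k}`. -/
def vBasis (k n : ℕ) : Module.Basis (Fin k → Fin n) ℂ (VTensor k n) :=
  Basis.piTensorProduct fun _ => Pi.basisFun ℂ (Fin n)

open Classical in
/-- The matrix entry `δ(d)` at the labelling `top` of the top row and `bot` of the bottom row:
`1` if the labels are constant on every block of `d`, and `0` otherwise. -/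
def diagDelta {k n : ℕ} (d : Diagram k) (top bot : Fin k → Fin n) : ℂ :=
  if ∀ x y : Fin k ⊕ Fin k, d x y → Sum.elim top bot x = Sum.elim top bot y then 1 else 0

/-- The action of a diagram `d` on `V^{⊗k}`. The bottom row is the input and the top row the output,
so that stacking `d₁` above `d₂` corresponds to the composition `d₁ ∘ d₂`. -/
def diagAct {k : ℕ} (n : ℕ) (d : Diagram k) : Module.End ℂ (VTensor k n) :=
  Matrix.toLin (vBasis k n) (vBasis k n) (Matrix.of fun top bot => diagDelta d top bot)

/-- On the basis: `d • (v_{j_1} ⊗ ⋯ ⊗ v_{j_k}) = ∑ δ(d) v_{i_1} ⊗ ⋯ ⊗ v_{i_k}`. -/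
theorem diagAct_tprod {k n : ℕ} (d : Diagram k) (bot : Fin k → Fin n) :
    diagAct n d (⨂ₜ[ℂ] l, Pi.single (bot l) (1 : ℂ)) =
      ∑ top : Fin k → Fin n, diagDelta d top bot • ⨂ₜ[ℂ] l, Pi.single (top l) (1 : ℂ) := by
  have h := Matrix.toLin_self (vBasis k n) (vBasis k n)
    (Matrix.of fun top bot => diagDelta d top bot) bot
  simpa [diagAct, vBasis] using h

/-- The projection `π = id - ϖ : V → W` along the trivial summand, where `ϖ` sends every `v_i` to
`(1/n) (v_1 + ⋯ + v_n)`. -/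
def proj (n : ℕ) : (Fin n → ℂ) →ₗ[ℂ] W n :=
  LinearMap.codRestrict (W n)
    (LinearMap.id - LinearMap.pi fun _ => (n : ℂ)⁻¹ • ∑ i, LinearMap.proj i) (by
      intro x
      rw [mem_W]
      rcases Nat.eq_zero_or_pos n with rfl | hn
      · simp
      · have hn' : (n : ℂ) ≠ 0 := by exact_mod_cast hn.ne'
        simp [Finset.sum_sub_distrib, hn'])

/-- `d̄ = π^{⊗k} ∘ d`, as the composition `W^{⊗k} → V^{⊗k} → V^{⊗k} → W^{⊗k}` of the map induced by
the inclusion `W ⊆ V`, the action of `d`, and `π^{⊗k}`. -/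
def bar {k : ℕ} (n : ℕ) (d : Diagram k) : Module.End ℂ (WTensor k n) :=
  PiTensorProduct.map (fun _ => proj n) ∘ₗ diagAct n d ∘ₗ PiTensorProduct.mapIncl fun _ => W n

end QuasiPartition

end

/-! Put `u_i = π v_i`. A labelling `x` of the 2k vertices by 1, …, n gives the operator `rankOne x`,
built from the `u`'s at the top labels and the coordinate functionals at the bottom labels. Then d̄
is the sum of `rankOne x` over the labellings constant on the blocks of d (`bar_eq_sum`). Since the
`u_i` sum to zero, as do the coordinates of a vector of W, `rankOne` sums to zero along every vertex
(`killed_rankOne`). So diagrams with singleton blocks vanish (`labelSum_eq_zero`), and in products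
the factors `κ = δ - 1/n` can often be replaced by `δ` (`sum_prod_kappa_smul`).

The d̄ span the centralizer (`mem_of_forall_bar_mem`): a commuting operator has coefficients
constant on S_n-orbits of labellings, and orbit sums are obtained from the d̄ by triangular
inversion over coarsenings.

Each d̄ lies in the generated algebra (`labelSum_mem_of_stable`), by induction on lexicographically
increasing (number of blocks, number of block-side incidences). Conjugating by permutations puts b,
e, t, h at arbitrary positions of either row. A block of at least four vertices is split by b, up to
corrections with more blocks. Once all blocks are pairs and triples, either the diagram is a
permutation or both rows contain two vertices sharing a block. In the latter case e breaks up a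
horizontal pair, t handles triples one of which has vertices in both rows, and h handles two triples
each contained in a row. -/

open scoped TensorProduct

noncomputable section

namespace QuasiPartition

open Function

/-! ## Sums over labellings -/

section Sums

variable {n : ℕ} {L M : Type*} [Fintype L] [DecidableEq L] [AddCommGroup M] [Module ℂ M]

/-- The matrix entries of the projection `π : V → W`. -/
def kappa {n : ℕ} (a b : Fin n) : ℂ := (if a = b then 1 else 0) - (n : ℂ)⁻¹

theorem kappa_comm (a b : Fin n) : kappa a b = kappa b a := by
  simp [kappa, eq_comm]

theorem sum_kappa_mul_kappa (a b : Fin n) : ∑ c, kappa c a * kappa c b = kappa a b := by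
  have hn : (n : ℂ) ≠ 0 := by
    have := a.pos
    exact_mod_cast this.ne'
  simp only [kappa, sub_mul, mul_sub, Finset.sum_sub_distrib, ite_mul, one_mul, zero_mul,
    Finset.sum_ite_eq', Finset.mem_univ, if_true, mul_ite, mul_one, mul_zero, Finset.sum_const,
    Finset.card_univ, Fintype.card_fin, nsmul_eq_mul]
  rw [show (if b = a then (1 : ℂ) else 0) = if a = b then 1 else 0 by simp only [eq_comm]]
  field_simp
  ring

theorem sum_sum_update (F : (L → Fin n) → M) (l : L) :
    ∑ φ, ∑ c, F (update φ l c) = (n : ℂ) • ∑ φ, F φ := by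
  -- The involution exchanging the value at `l` with the separate value `c`.
  let e : (L → Fin n) × Fin n ≃ (L → Fin n) × Fin n :=
    { toFun := fun x => (update x.1 l x.2, x.1 l)
      invFun := fun x => (update x.1 l x.2, x.1 l)
      left_inv := fun x => by simp
      right_inv := fun x => by simp }
  have h := Equiv.sum_comp e fun x => F x.1
  rw [Fintype.sum_prod_type, Fintype.sum_prod_type] at h
  refine h.trans ?_
  simp only [Finset.sum_const, Finset.card_univ, Fintype.card_fin, Finset.smul_sum,
    Nat.cast_smul_eq_nsmul]

theorem sum_eq_zero_of_sum_update [NeZero n] {F : (L → Fin n) → M} {l : L}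
    (h : ∀ φ, ∑ c, F (update φ l c) = 0) : ∑ φ, F φ = 0 := by
  have h1 := sum_sum_update F l
  simp only [h, Finset.sum_const_zero] at h1
  exact (smul_eq_zero.mp h1.symm).resolve_left (NeZero.ne _)

/-- Factors `κ` attached to labels along which `G` sums to zero may be replaced by `δ`. -/
theorem sum_prod_kappa_smul [NeZero n] (S : Finset L) (t : L → Fin n) (G : (L → Fin n) → M)
    (hG : ∀ l ∈ S, ∀ φ, ∑ c, G (update φ l c) = 0) :
    ∑ φ, (∏ l ∈ S, kappa (φ l) (t l)) • G φ =
      ∑ φ, (∏ l ∈ S, if φ l = t l then (1 : ℂ) else 0) • G φ := by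
  induction S using Finset.induction_on generalizing G with
  | empty => simp
  | insert a S ha ih =>
    -- The `1/n` part of `κ` at `a` leaves a weight independent of `φ a`, so summing over `φ a`
    -- annihilates it.
    have key : ∀ w : L → Fin n → ℂ,
        ∑ φ, ((n : ℂ)⁻¹ * ∏ l ∈ S, w l (φ l)) • G φ = 0 := by
      intro w
      refine sum_eq_zero_of_sum_update (l := a) fun φ => ?_
      have : ∀ c, ∏ l ∈ S, w l (update φ a c l) = ∏ l ∈ S, w l (φ l) := fun c =>
        Finset.prod_congr rfl fun l hl => by
          rw [update_of_ne (ne_of_mem_of_not_mem hl ha)]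
      simp only [this, ← Finset.smul_sum, hG a (Finset.mem_insert_self _ _), smul_zero]
    have h1 : ∑ φ, (∏ l ∈ insert a S, kappa (φ l) (t l)) • G φ =
        ∑ φ, (∏ l ∈ S, kappa (φ l) (t l)) • ((if φ a = t a then (1 : ℂ) else 0) • G φ) := by
      rw [← sub_eq_zero, ← Finset.sum_sub_distrib, ← neg_eq_zero, ← Finset.sum_neg_distrib,
        ← key fun l x => kappa x (t l)]
      refine Finset.sum_congr rfl fun φ _ => ?_
      rw [Finset.prod_insert ha, smul_smul, ← sub_smul, ← neg_smul]
      congr 1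
      simp only [kappa]
      ring
    rw [h1, ih]
    · refine Finset.sum_congr rfl fun φ _ => ?_
      rw [Finset.prod_insert ha, smul_smul, mul_comm]
    · intro l hl φ
      have : a ≠ l := (ne_of_mem_of_not_mem hl ha).symm
      simp only [update_of_ne this, ← Finset.smul_sum, hG l (Finset.mem_insert_of_mem hl),
        smul_zero]

theorem sum_ite_eq_smul (F : (L → Fin n) → M) (l : L) (x : Fin n) :
    ∑ φ, (if φ l = x then (1 : ℂ) else 0) • ∑ c, F (update φ l c) = ∑ φ, F φ := by
  have : NeZero n := ⟨x.pos.ne'⟩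
  refine smul_right_injective M (NeZero.ne (n : ℂ)) ?_
  simp only
  rw [← sum_sum_update (fun φ => (if φ l = x then (1 : ℂ) else 0) • ∑ c, F (update φ l c)) l,
    ← sum_sum_update F l]
  simp [ite_smul]

/-- Summing over the labellings that agree with `x` off `insert a T`. -/
theorem sum_prod_delta_insert (T : Finset L) {a : L} (ha : a ∉ T) (x : L → Fin n)
    (F : (L → Fin n) → M) :
    ∑ φ, (∏ l ∈ (insert a T)ᶜ, if φ l = x l then (1 : ℂ) else 0) • F φ =
      ∑ φ, (∏ l ∈ Tᶜ, if φ l = x l then (1 : ℂ) else 0) • ∑ c, F (update φ a c) := by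
  rw [← sum_ite_eq_smul _ a (x a)]
  refine Finset.sum_congr rfl fun φ _ => ?_
  have h1 : Tᶜ = insert a (insert a T)ᶜ := by
    ext l
    simp only [Finset.mem_compl, Finset.mem_insert]
    grind
  have h2 : ∀ c, (∏ l ∈ (insert a T)ᶜ, if update φ a c l = x l then (1 : ℂ) else 0) =
      ∏ l ∈ (insert a T)ᶜ, if φ l = x l then (1 : ℂ) else 0 := fun c =>
    Finset.prod_congr rfl fun l hl => by
      rw [update_of_ne]
      rintro rfl
      simp at hl
  rw [h1, Finset.prod_insert (by simp), mul_smul]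
  simp only [h2, Finset.smul_sum]

theorem sum_prod_delta_univ (x : L → Fin n) (F : (L → Fin n) → M) :
    ∑ φ, (∏ l ∈ (∅ : Finset L)ᶜ, if φ l = x l then (1 : ℂ) else 0) • F φ = F x := by
  have : ∀ φ : L → Fin n, (∏ l ∈ (∅ : Finset L)ᶜ, if φ l = x l then (1 : ℂ) else 0) =
      if φ = x then 1 else 0 := by
    intro φ
    rw [Finset.compl_empty, Finset.prod_ite_zero]
    simp [funext_iff]
  simp only [this, ite_smul, one_smul, zero_smul, Finset.sum_ite_eq', Finset.mem_univ, if_true]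

end Sums

/-! ## Reduction rules -/

section Rules

variable {n : ℕ} {V L M : Type*} [DecidableEq V] [Fintype L] [DecidableEq L]
  [AddCommGroup M] [Module ℂ M]

/-- `E` sums to zero along every vertex. -/
def Killed (E : (V → Fin n) → M) : Prop := ∀ x v, ∑ c, E (update x v c) = 0

/-- The sum of `E` over the vertex labellings that factor through `f`. -/
def labelSum (E : (V → Fin n) → M) (f : V → L) : M := ∑ φ : L → Fin n, E (φ ∘ f)

theorem labelSum_eq_zero [NeZero n] {E : (V → Fin n) → M} (hE : Killed E) {f : V → L} {v : V}
    (hv : ∀ w, f w = f v → w = v) : labelSum E f = 0 := by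
  refine sum_eq_zero_of_sum_update (l := f v) fun φ => ?_
  rw [← hE (φ ∘ f) v]
  refine Finset.sum_congr rfl fun c _ => congrArg E ?_
  ext w : 1
  simp only [comp_apply, update_apply]
  grind

/-- `Q` is stable under a linear map acting as `b` at the vertices `p`, `q`. -/
def StableB (Q : Submodule ℂ M) (E : (V → Fin n) → M) (p q : V) : Prop :=
  ∃ T : M →ₗ[ℂ] M, (∀ m ∈ Q, T m ∈ Q) ∧
    ∀ x, T (E x) = ∑ c, (kappa c (x p) * kappa c (x q)) • E (update (update x p c) q c)

/-- `Q` is stable under a linear map acting as `e` at the vertices `p`, `q`. -/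
def StableE (Q : Submodule ℂ M) (E : (V → Fin n) → M) (p q : V) : Prop :=
  ∃ T : M →ₗ[ℂ] M, (∀ m ∈ Q, T m ∈ Q) ∧
    ∀ x, T (E x) = kappa (x p) (x q) • ∑ c, E (update (update x p c) q c)

/-- `Q` is stable under a linear map acting as `t` at the vertices `p`, `q`, `r`. -/
def StableT (Q : Submodule ℂ M) (E : (V → Fin n) → M) (p q r : V) : Prop :=
  ∃ T : M →ₗ[ℂ] M, (∀ m ∈ Q, T m ∈ Q) ∧
    ∀ x, T (E x) = ∑ y, ∑ z, (kappa y (x p) * (kappa z (x q) * kappa z (x r))) •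
      E (update (update (update x p y) q y) r z)

/-- `Q` is stable under a linear map acting as `h` at the vertices `p`, `q`, `r`. -/
def StableH (Q : Submodule ℂ M) (E : (V → Fin n) → M) (p q r : V) : Prop :=
  ∃ T : M →ₗ[ℂ] M, (∀ m ∈ Q, T m ∈ Q) ∧
    ∀ x, T (E x) = ∑ y, (kappa y (x p) * (kappa y (x q) * kappa y (x r))) •
      ∑ z, E (update (update (update x p z) q z) r z)

/-- Split `q, w` off into a block `o` and let b merge them back. Expanding the two factors `κ = δ -
1/n` gives four terms: the `δδ` term is `f` up to a power of `n`, and the others attach `p, q` to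
`a`, to `o`, or to a new block `o'`. -/
theorem labelSum_mem_of_stableB [NeZero n] {Q : Submodule ℂ M} {E : (V → Fin n) → M}
    {p q w : V} (hT : StableB Q E p q) {f : V → L} {a o o' : L}
    (hp : f p = a) (hq : f q = a) (hw : f w = a)
    (hpq : p ≠ q) (hpw : p ≠ w) (hqw : q ≠ w) (ho : ∀ x, f x ≠ o) (ho' : ∀ x, f x ≠ o') (hoo : o ≠ o')
    (h0 : labelSum E (update (update f q o) w o) ∈ Q)
    (h1 : labelSum E (update f w o) ∈ Q)
    (h2 : labelSum E (update (update (update f p o) q o) w o) ∈ Q)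
    (h3 : labelSum E (update (update (update f w o) p o') q o') ∈ Q) :
    labelSum E f ∈ Q := by
  obtain ⟨T, hTQ, hT⟩ := hT
  set f' := update (update f q o) w o with hf'
  let G : (L → Fin n) → Fin n → M := fun φ c => E (update (update (φ ∘ f') p c) q c)
  have hao : a ≠ o := fun h => ho p (hp.trans h)
  have key : T (labelSum E f') = ∑ φ, (if φ o = φ a then (1 : ℂ) else 0) • G φ (φ o) -
      (n : ℂ)⁻¹ • ∑ φ, G φ (φ a) - (n : ℂ)⁻¹ • ∑ φ, G φ (φ o) +
      ((n : ℂ)⁻¹ * (n : ℂ)⁻¹) • ∑ φ, ∑ c, G φ c := by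
    simp only [labelSum, map_sum, Finset.smul_sum, ← Finset.sum_sub_distrib,
      ← Finset.sum_add_distrib]
    refine Finset.sum_congr rfl fun φ _ => ?_
    have e1 : (φ ∘ f') p = φ a := by
      simp only [comp_apply, update_apply, hf']
      grind
    have e2 : (φ ∘ f') q = φ o := by
      simp only [comp_apply, update_apply, hf']
      grind
    rw [hT, e1, e2]
    simp only [kappa, sub_mul, mul_sub, sub_smul, ite_mul, one_mul, zero_mul, mul_ite, mul_one,
      mul_zero, ite_smul, zero_smul, one_smul, Finset.sum_sub_distrib, Finset.sum_ite_eq',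
      Finset.mem_univ, if_true]
    simp only [G]
    abel
  have s1 : (n : ℂ) • ∑ φ, (if φ o = φ a then (1 : ℂ) else 0) • G φ (φ o) = labelSum E f := by
    rw [labelSum, ← sum_sum_update _ o]
    refine Finset.sum_congr rfl fun φ _ => ?_
    simp only [update_self, update_of_ne hao, ite_smul, one_smul, zero_smul,
      Finset.sum_ite_eq', Finset.mem_univ, if_true, G]
    refine congrArg E ?_
    ext x : 1
    simp only [comp_apply, update_apply, hf']
    grind
  have s2 : ∑ φ, G φ (φ a) = labelSum E (update f w o) := by
    refine Finset.sum_congr rfl fun φ _ => congrArg E ?_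
    ext x : 1
    simp only [comp_apply, update_apply, hf']
    grind
  have s3 : ∑ φ, G φ (φ o) = labelSum E (update (update (update f p o) q o) w o) := by
    refine Finset.sum_congr rfl fun φ _ => congrArg E ?_
    ext x : 1
    simp only [comp_apply, update_apply, hf']
    grind
  have s4 : ∑ φ, ∑ c, G φ c =
      (n : ℂ) • labelSum E (update (update (update f w o) p o') q o') := by
    rw [labelSum, ← sum_sum_update _ o']
    refine Finset.sum_congr rfl fun φ _ => Finset.sum_congr rfl fun c _ => congrArg E ?_
    ext x : 1
    simp only [comp_apply, update_apply, hf']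
    grind
  rw [s2, s3, s4] at key
  have h4 : ∑ φ, (if φ o = φ a then (1 : ℂ) else 0) • G φ (φ o) ∈ Q := by
    have h5 := hTQ _ h0
    rw [key] at h5
    have h6 := Q.sub_mem h5 (Q.smul_mem ((n : ℂ)⁻¹ * (n : ℂ)⁻¹) (Q.smul_mem (n : ℂ) h3))
    have h7 := Q.add_mem (Q.add_mem h6 (Q.smul_mem (n : ℂ)⁻¹ h2)) (Q.smul_mem (n : ℂ)⁻¹ h1)
    convert h7 using 1
    abel
  rw [← s1]
  exact Q.smul_mem _ h4

/-- In `f'` the block `a` is `{p, u}`. Once e has overwritten `p` and `q`, only `u` carries `a`, so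
the `1/n` part of `κ` dies; the `δ` part returns `u` to `c` and joins `p, q`. -/
theorem labelSum_mem_of_stableE [NeZero n] {Q : Submodule ℂ M} {E : (V → Fin n) → M}
    (hE : Killed E) {p q u : V} (hT : StableE Q E p q) {f : V → L} {a c : L}
    (hp : f p = a) (hq : f q = a) (hu : f u = c) (hpq : p ≠ q) (hac : a ≠ c)
    (ha : ∀ x, f x = a → x = p ∨ x = q)
    (h0 : labelSum E (update (update f u a) q c) ∈ Q) : labelSum E f ∈ Q := by
  obtain ⟨T, hTQ, hT⟩ := hT
  set f' := update (update f u a) q c with hf'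
  have huq : u ≠ q := by rintro rfl; exact hac (hq.symm.trans hu)
  have hup : u ≠ p := by rintro rfl; exact hac (hp.symm.trans hu)
  let H : (L → Fin n) → M := fun φ => ∑ z, E (update (update (φ ∘ f') p z) q z)
  have hH : ∀ φ, ∑ d, H (update φ a d) = 0 := by
    intro φ
    simp only [H]
    rw [Finset.sum_comm]
    refine Finset.sum_eq_zero fun z _ => ?_
    rw [← hE (update (update (φ ∘ f') p z) q z) u]
    refine Finset.sum_congr rfl fun d _ => congrArg E ?_
    ext x : 1
    simp only [comp_apply, update_apply, hf']
    grind
  have h1 : T (labelSum E f') = ∑ φ, (if φ a = φ c then (1 : ℂ) else 0) • H φ := by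
    have h0 : ∑ φ, (n : ℂ)⁻¹ • H φ = 0 := by
      rw [← Finset.smul_sum, sum_eq_zero_of_sum_update hH, smul_zero]
    rw [← sub_zero (∑ φ, _), ← h0, ← Finset.sum_sub_distrib, labelSum, map_sum]
    refine Finset.sum_congr rfl fun φ _ => ?_
    rw [hT, ← sub_smul]
    have e1 : (φ ∘ f') p = φ a := by
      simp only [comp_apply, update_apply, hf']
      grind
    have e2 : (φ ∘ f') q = φ c := by simp [hf']
    rw [e1, e2]
    rfl
  -- With `φ a` forced to equal `φ c`, the summation variable of e takes over as the label of `p,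
  -- q`; averaging both sides over label `a` matches the two.
  have h2 : (n : ℂ) • T (labelSum E f') = (n : ℂ) • labelSum E f := by
    rw [h1, labelSum, ← sum_sum_update _ a, ← sum_sum_update _ a]
    refine Finset.sum_congr rfl fun φ _ => ?_
    simp only [update_self, update_of_ne hac.symm, ite_smul, one_smul, zero_smul,
      Finset.sum_ite_eq', Finset.mem_univ, if_true, H]
    refine Finset.sum_congr rfl fun d _ => congrArg E ?_
    ext x : 1
    simp only [comp_apply, update_apply, hf']
    grind
  rw [← smul_right_injective M (NeZero.ne (n : ℂ)) h2]
  exact hTQ _ h0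

/-- The triples `{p, q, w}` and `{r, u, v}` come from the three pairs `{p, w}`, `{q, u}`, `{r, v}`.
No correction terms survive, because each pair keeps exactly one vertex that t does not touch. -/
theorem labelSum_mem_of_stableT [NeZero n] {Q : Submodule ℂ M} {E : (V → Fin n) → M}
    (hE : Killed E) {p q r u v w : V} (hT : StableT Q E p q r) {f : V → L} {a c o : L}
    (hp : f p = a) (hq : f q = a) (hw : f w = a) (hr : f r = c) (hu : f u = c) (hv : f v = c)
    (hpq : p ≠ q) (hpw : p ≠ w) (hqw : q ≠ w) (hru : r ≠ u) (hrv : r ≠ v) (huv : u ≠ v)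
    (ha : ∀ x, f x = a → x = p ∨ x = q ∨ x = w) (hc : ∀ x, f x = c → x = r ∨ x = u ∨ x = v)
    (hac : a ≠ c) (ho : ∀ x, f x ≠ o)
    (h0 : labelSum E (update (update f q o) u o) ∈ Q) : labelSum E f ∈ Q := by
  obtain ⟨T, hTQ, hT⟩ := hT
  set f' := update (update f q o) u o with hf'
  have hao : a ≠ o := fun h => ho p (hp.trans h)
  have hco : c ≠ o := fun h => ho r (hr.trans h)
  let X : (L → Fin n) → Fin n → Fin n → V → Fin n := fun φ y z =>
    update (update (update (φ ∘ f') p y) q y) r z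
  have h1 : T (labelSum E f') = ∑ y, ∑ z, ∑ φ, (∏ l ∈ {a, o, c},
      kappa (φ l) (if l = a then y else z)) • E (X φ y z) := by
    rw [labelSum, map_sum]
    simp only [hT]
    rw [Finset.sum_comm]
    refine Finset.sum_congr rfl fun y _ => ?_
    rw [Finset.sum_comm]
    refine Finset.sum_congr rfl fun z _ => Finset.sum_congr rfl fun φ _ => ?_
    have e1 : f' p = a := by
      simp only [update_apply, hf']
      grind
    have e2 : f' q = o := by
      simp only [update_apply, hf']
      grind
    have e3 : f' r = c := by
      simp only [update_apply, hf']
      grind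
    rw [Finset.prod_insert (by simp [hao, hac]), Finset.prod_insert (by simp [hco.symm]),
      Finset.prod_singleton, if_pos rfl, if_neg hao.symm, if_neg hac.symm, comp_apply, comp_apply,
      comp_apply, e1, e2, e3, kappa_comm y, kappa_comm z, kappa_comm z]
  have h2 : T (labelSum E f') = ∑ φ : L → Fin n,
      (if φ o = φ c then (1 : ℂ) else 0) • E (X φ (φ a) (φ c)) := by
    have h3 : ∀ y z, ∑ φ, (∏ l ∈ {a, o, c}, kappa (φ l) (if l = a then y else z)) • E (X φ y z) =
        ∑ φ : L → Fin n, if y = φ a then if z = φ c then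
          (if φ o = φ c then (1 : ℂ) else 0) • E (X φ (φ a) (φ c)) else 0 else 0 := by
      intro y z
      rw [sum_prod_kappa_smul {a, o, c} (fun l => if l = a then y else z)]
      · refine Finset.sum_congr rfl fun φ _ => ?_
        rw [Finset.prod_insert (by simp [hao, hac]), Finset.prod_insert (by simp [hco.symm]),
          Finset.prod_singleton, if_neg hao.symm, if_neg hac.symm]
        simp only [if_true]
        by_cases hy : y = φ a
        · by_cases hz : z = φ c
          · subst hy hz
            simp
          · simp [hz, Ne.symm hz]
        · simp [hy, Ne.symm hy]
      · intro l hl φ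
        -- The vertices `p, q, r` are overwritten in `X`, so `w`, `u`, `v` are the only carriers of
        -- `a`, `o`, `c`.
        have h4 : ∃ s, s ≠ p ∧ s ≠ q ∧ s ≠ r ∧ f' s = l ∧
            ∀ x, f' x = l → x = s ∨ x = p ∨ x = q ∨ x = r := by
          simp only [Finset.mem_insert, Finset.mem_singleton] at hl
          rcases hl with rfl | rfl | rfl
          · refine ⟨w, ?_⟩
            simp only [update_apply, hf']
            grind
          · refine ⟨u, ?_⟩
            simp only [update_apply, hf']
            grind
          · refine ⟨v, ?_⟩
            simp only [update_apply, hf']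
            grind
        obtain ⟨s, hsp, hsq, hsr, hs, hsx⟩ := h4
        rw [← hE (X φ y z) s]
        refine Finset.sum_congr rfl fun d _ => congrArg E ?_
        ext x : 1
        simp only [X, comp_apply, update_apply]
        grind
    rw [h1]
    simp only [h3]
    rw [Finset.sum_congr rfl fun y _ => Finset.sum_comm, Finset.sum_comm]
    simp
  have h5 : (n : ℂ) • T (labelSum E f') = labelSum E f := by
    rw [h2, labelSum, ← sum_sum_update _ o]
    refine Finset.sum_congr rfl fun φ _ => ?_
    simp only [update_self, update_of_ne hao, update_of_ne hco, ite_smul, one_smul, zero_smul,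
      Finset.sum_ite_eq', Finset.mem_univ, if_true, X]
    refine congrArg E ?_
    ext x : 1
    simp only [comp_apply, update_apply, hf']
    grind
  rw [← h5]
  exact Q.smul_mem _ (hTQ _ h0)

/-- The same mechanism with the pairs `{p, u}`, `{q, v}`, `{r, w}`: all three `κ` become `δ`, which
fuses `u, v, w`, while h gives `p, q, r` a new common label. -/
theorem labelSum_mem_of_stableH [NeZero n] {Q : Submodule ℂ M} {E : (V → Fin n) → M}
    (hE : Killed E) {p q r u v w : V} (hT : StableH Q E p q r) {f : V → L} {a c o : L}
    (hp : f p = a) (hq : f q = a) (hr : f r = a) (hu : f u = c) (hv : f v = c) (hw : f w = c)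
    (hpq : p ≠ q) (hpr : p ≠ r) (hqr : q ≠ r) (huv : u ≠ v) (huw : u ≠ w) (hvw : v ≠ w)
    (ha : ∀ x, f x = a → x = p ∨ x = q ∨ x = r) (hc : ∀ x, f x = c → x = u ∨ x = v ∨ x = w)
    (hac : a ≠ c) (ho : ∀ x, f x ≠ o)
    (h0 : labelSum E (update (update (update (update f u a) q c) r o) w o) ∈ Q) :
    labelSum E f ∈ Q := by
  obtain ⟨T, hTQ, hT⟩ := hT
  set f' := update (update (update (update f u a) q c) r o) w o with hf'
  have hao : a ≠ o := fun h => ho p (hp.trans h)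
  have hco : c ≠ o := fun h => ho u (hu.trans h)
  let H : (L → Fin n) → M := fun φ =>
    ∑ z, E (update (update (update (φ ∘ f') p z) q z) r z)
  have h1 : T (labelSum E f') = ∑ y, ∑ φ, (∏ l ∈ {a, c, o}, kappa (φ l) y) • H φ := by
    rw [labelSum, map_sum]
    simp only [hT]
    rw [Finset.sum_comm]
    refine Finset.sum_congr rfl fun y _ => Finset.sum_congr rfl fun φ _ => ?_
    have e1 : f' p = a := by
      simp only [update_apply, hf']
      grind
    have e2 : f' q = c := by
      simp only [update_apply, hf']
      grind
    have e3 : f' r = o := by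
      simp only [update_apply, hf']
      grind
    rw [Finset.prod_insert (by simp [hao, hac]), Finset.prod_insert (by simp [hco]),
      Finset.prod_singleton, comp_apply, comp_apply,
      comp_apply, e1, e2, e3, kappa_comm y, kappa_comm y, kappa_comm y]
  have hH : ∀ l ∈ ({a, c, o} : Finset L), ∀ φ, ∑ d, H (update φ l d) = 0 := by
    intro l hl φ
    have h4 : ∃ s, s ≠ p ∧ s ≠ q ∧ s ≠ r ∧ f' s = l ∧
        ∀ x, f' x = l → x = s ∨ x = p ∨ x = q ∨ x = r := by
      simp only [Finset.mem_insert, Finset.mem_singleton] at hl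
      rcases hl with rfl | rfl | rfl
      · refine ⟨u, ?_⟩
        simp only [update_apply, hf']
        grind
      · refine ⟨v, ?_⟩
        simp only [update_apply, hf']
        grind
      · refine ⟨w, ?_⟩
        simp only [update_apply, hf']
        grind
    obtain ⟨s, hsp, hsq, hsr, hs, hsx⟩ := h4
    simp only [H]
    rw [Finset.sum_comm]
    refine Finset.sum_eq_zero fun z _ => ?_
    rw [← hE (update (update (update (φ ∘ f') p z) q z) r z) s]
    refine Finset.sum_congr rfl fun d _ => congrArg E ?_
    ext x : 1
    simp only [comp_apply, update_apply]
    grind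
  have h2 : T (labelSum E f') = ∑ φ : L → Fin n,
      (if φ a = φ c then (1 : ℂ) else 0) • (if φ o = φ c then (1 : ℂ) else 0) • H φ := by
    simp only [sum_prod_kappa_smul {a, c, o} (fun _ => _) H hH] at h1
    rw [h1, Finset.sum_comm]
    refine Finset.sum_congr rfl fun φ _ => ?_
    rw [Finset.sum_eq_single (φ c)]
    · rw [Finset.prod_insert (by simp [hao, hac]), Finset.prod_insert (by simp [hco]),
        Finset.prod_singleton, if_pos (rfl : φ c = φ c), one_mul, mul_smul]
    · intro y _ hy
      rw [Finset.prod_insert (by simp [hao, hac]), Finset.prod_insert (by simp [hco]),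
        if_neg (Ne.symm hy), zero_mul, mul_zero, zero_smul]
    · simp
  have h5 : (n : ℂ) • (n : ℂ) • T (labelSum E f') = (n : ℂ) • labelSum E f := by
    rw [h2, labelSum, ← sum_sum_update _ o]
    simp only [update_self, update_of_ne hao, update_of_ne hco, ite_smul, one_smul, zero_smul]
    rw [← sum_sum_update _ a, ← sum_sum_update _ a]
    refine Finset.sum_congr rfl fun φ _ => ?_
    simp only [update_self, update_of_ne hac.symm, Finset.sum_ite_irrel,
      Finset.sum_ite_eq', Finset.mem_univ, if_true, H, Finset.sum_const_zero]
    refine Finset.sum_congr rfl fun d _ => congrArg E ?_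
    ext x : 1
    simp only [comp_apply, update_apply, hf']
    grind
  rw [← smul_right_injective M (NeZero.ne (n : ℂ)) h5]
  exact Q.smul_mem _ (hTQ _ h0)

end Rules

/-! ## Rank one operators on `W^{⊗k}` -/

section RankOne

variable {k n : ℕ}

/-- The projections `u_i = π v_i` of the standard basis vectors. -/
def projVec {n : ℕ} (i : Fin n) : W n := proj n (Pi.single i 1)

theorem coe_proj_apply (x : Fin n → ℂ) (c : Fin n) :
    (proj n x : Fin n → ℂ) c = x c - (n : ℂ)⁻¹ * ∑ i, x i := by
  simp [proj]

theorem projVec_apply (i c : Fin n) : (projVec i : Fin n → ℂ) c = kappa c i := by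
  rw [projVec, coe_proj_apply, Finset.sum_pi_single']
  simp [Pi.single_apply, kappa]

theorem proj_coe (w : W n) : proj n (w : Fin n → ℂ) = w := by
  ext c
  rw [coe_proj_apply, mem_W.mp w.2, mul_zero, sub_zero]

theorem sum_smul_projVec (x : Fin n → ℂ) : ∑ c, x c • projVec c = proj n x := by
  simp only [projVec, ← map_smul, ← map_sum]
  congr 1
  ext j
  simp [Pi.single_apply]

theorem sum_projVec : ∑ c : Fin n, projVec c = 0 := by
  have h := sum_smul_projVec fun _ : Fin n => (1 : ℂ)
  simp only [one_smul] at h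
  rw [h]
  ext c
  have : (n : ℂ) ≠ 0 := by
    have := c.pos
    exact_mod_cast this.ne'
  rw [coe_proj_apply]
  simp [this]

/-- `u_{x_1} ⊗ ⋯ ⊗ u_{x_k}`. -/
def tensorVec (x : Fin k → Fin n) : WTensor k n := ⨂ₜ[ℂ] l, projVec (x l)

/-- The functional `w_1 ⊗ ⋯ ⊗ w_k ↦ ∏ (w_l)_{x_l}` on `W^{⊗k}`. -/
def coordFun (x : Fin k → Fin n) : WTensor k n →ₗ[ℂ] ℂ :=
  PiTensorProduct.lift ((MultilinearMap.mkPiAlgebra ℂ (Fin k) ℂ).compLinearMap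
    fun l => LinearMap.proj (x l) ∘ₗ (W n).subtype)

theorem coordFun_tprod (x : Fin k → Fin n) (w : Fin k → W n) :
    coordFun x (⨂ₜ[ℂ] l, w l) = ∏ l, (w l : Fin n → ℂ) (x l) := by
  simp [coordFun]

theorem coordFun_tensorVec (x y : Fin k → Fin n) :
    coordFun x (tensorVec y) = ∏ l, kappa (x l) (y l) := by
  rw [tensorVec, coordFun_tprod]
  simp only [projVec_apply]

theorem killed_tensorVec : Killed (tensorVec : (Fin k → Fin n) → WTensor k n) := by
  intro x v
  have h : ∀ c, tensorVec (update x v c) =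
      PiTensorProduct.tprod ℂ (update (fun l => projVec (x l)) v (projVec c)) := by
    intro c
    rw [tensorVec]
    congr 1
    ext l : 1
    by_cases hl : l = v
    · subst hl; simp
    · simp [hl]
  simp only [h]
  rw [← MultilinearMap.map_update_sum, sum_projVec, MultilinearMap.map_update_zero]

theorem killed_coordFun : Killed (coordFun : (Fin k → Fin n) → WTensor k n →ₗ[ℂ] ℂ) := by
  intro x v
  ext w
  simp only [LinearMap.compMultilinearMap_apply, LinearMap.sum_apply, coordFun_tprod,
    LinearMap.zero_apply]
  have h : ∀ c, ∏ l, (w l : Fin n → ℂ) (update x v c l) =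
      (w v : Fin n → ℂ) c * ∏ l ∈ Finset.univ.erase v, (w l : Fin n → ℂ) (x l) := by
    intro c
    rw [← Finset.mul_prod_erase _ _ (Finset.mem_univ v), update_self]
    congr 1
    exact Finset.prod_congr rfl fun l hl => by rw [update_of_ne (Finset.ne_of_mem_erase hl)]
  simp only [h, ← Finset.sum_mul, mem_W.mp (w v).2, zero_mul]

/-- The operator of rank one whose image is spanned by the tensor at the top labels, with the
functional at the bottom labels. -/
def rankOne (x : Fin k ⊕ Fin k → Fin n) : Module.End ℂ (WTensor k n) :=
  (coordFun fun l => x (Sum.inr l)).smulRight (tensorVec fun l => x (Sum.inl l))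

theorem rankOne_apply (x : Fin k ⊕ Fin k → Fin n) (t : WTensor k n) :
    rankOne x t = coordFun (fun l => x (Sum.inr l)) t • tensorVec fun l => x (Sum.inl l) := rfl

theorem rankOne_mul (x y : Fin k ⊕ Fin k → Fin n) :
    rankOne x * rankOne y = (∏ l, kappa (x (Sum.inr l)) (y (Sum.inl l))) •
      rankOne (Sum.elim (fun l => x (Sum.inl l)) fun l => y (Sum.inr l)) := by
  ext1
  ext w
  simp only [LinearMap.compMultilinearMap_apply, Module.End.mul_apply, rankOne_apply, map_smul,
    LinearMap.smul_apply, coordFun_tensorVec, Sum.elim_inl, Sum.elim_inr, smul_smul]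
  rw [mul_comm]

instance : AddCommGroup (Module.End ℂ (WTensor k n)) := Module.addCommMonoidToAddCommGroup ℂ

theorem killed_rankOne : Killed (rankOne : (Fin k ⊕ Fin k → Fin n) → _) := by
  rintro x (v | v)
  · have h := killed_tensorVec (fun l => x (Sum.inl l)) v
    ext1
    ext w
    simp only [LinearMap.compMultilinearMap_apply, LinearMap.sum_apply, rankOne_apply]
    have h1 : ∀ c l, update x (Sum.inl v) c (Sum.inl l) =
        update (fun l => x (Sum.inl l)) v c l := fun c l => by
      simp [update_apply]
    simp only [h1, update_of_ne Sum.inr_ne_inl, ← Finset.smul_sum, h, smul_zero,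
      LinearMap.zero_apply]
  · have h := killed_coordFun (fun l => x (Sum.inr l)) v
    ext1
    ext w
    simp only [LinearMap.compMultilinearMap_apply, LinearMap.sum_apply, rankOne_apply]
    have h1 : ∀ c l, update x (Sum.inr v) c (Sum.inr l) =
        update (fun l => x (Sum.inr l)) v c l := fun c l => by
      simp [update_apply]
    simp only [h1, update_of_ne Sum.inl_ne_inr, ← Finset.sum_smul, ← LinearMap.sum_apply, h,
      LinearMap.zero_apply, zero_smul]

theorem sum_rankOne_diag :
    ∑ i : Fin k → Fin n, rankOne (Sum.elim i i) = 1 := by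
  ext1
  ext w
  simp only [LinearMap.compMultilinearMap_apply, LinearMap.sum_apply, rankOne_apply,
    Sum.elim_inl, Sum.elim_inr, coordFun_tprod, Module.End.one_apply]
  have h : ∀ l, w l = ∑ c, (w l : Fin n → ℂ) c • projVec c := fun l => by
    rw [sum_smul_projVec, proj_coe]
  conv_rhs => rw [show w = fun l => ∑ c, (w l : Fin n → ℂ) c • projVec c from funext h]
  rw [MultilinearMap.map_sum]
  simp only [MultilinearMap.map_smul_univ]
  rfl

open Classical in
theorem bar_eq_sum (d : Diagram k) :
    bar n d = ∑ x : Fin k ⊕ Fin k → Fin n, if d ≤ Setoid.ker x then rankOne x else 0 := by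
  ext1
  ext1 w
  simp only [LinearMap.compMultilinearMap_apply, LinearMap.sum_apply, bar, LinearMap.comp_apply,
    PiTensorProduct.mapIncl, PiTensorProduct.map_tprod]
  have h : ∀ l, (W n).subtype (w l) = ∑ c, (w l : Fin n → ℂ) c • Pi.single c (1 : ℂ) := fun l => by
    ext j
    simp [Pi.single_apply]
  rw [show (fun l => (W n).subtype (w l)) =
    fun l => ∑ c, (w l : Fin n → ℂ) c • Pi.single c (1 : ℂ) from funext h]
  rw [MultilinearMap.map_sum]
  simp only [MultilinearMap.map_smul_univ, map_sum, map_smul, diagAct_tprod,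
    PiTensorProduct.map_tprod]
  rw [← Equiv.sum_comp (Equiv.sumArrowEquivProdArrow (Fin k) (Fin k) (Fin n)).symm,
    Fintype.sum_prod_type_right]
  refine Finset.sum_congr rfl fun bot _ => ?_
  rw [Finset.smul_sum]
  refine Finset.sum_congr rfl fun top _ => ?_
  change _ • diagDelta d top bot • tensorVec top =
    (if d ≤ Setoid.ker (Sum.elim top bot) then rankOne (Sum.elim top bot) else 0) _
  rw [diagDelta]
  have : (∀ x y, d x y → Sum.elim top bot x = Sum.elim top bot y) ↔
      d ≤ Setoid.ker (Sum.elim top bot) := Iff.rfl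
  simp only [this]
  split_ifs
  · simp only [one_smul, rankOne_apply, Sum.elim_inl, Sum.elim_inr, coordFun_tprod]
  · simp

/-! ### Equivariance, and the projected diagrams span the centralizer -/

theorem wTensorRep_tensorVec (σ : Equiv.Perm (Fin n)) (x : Fin k → Fin n) :
    wTensorRep k n σ (tensorVec x) = tensorVec (σ ∘ x) := by
  change PiTensorProduct.map (fun _ => wRep n σ) (tensorVec x) = _
  rw [tensorVec, PiTensorProduct.map_tprod, tensorVec]
  congr 1
  ext l c
  change (projVec (x l) : Fin n → ℂ) (σ⁻¹ c) = _
  rw [projVec_apply, projVec_apply]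
  simp [kappa, Equiv.symm_apply_eq]

theorem coordFun_wTensorRep (σ : Equiv.Perm (Fin n)) (x : Fin k → Fin n) (t : WTensor k n) :
    coordFun (σ ∘ x) (wTensorRep k n σ t) = coordFun x t := by
  change (coordFun (σ ∘ x) ∘ₗ wTensorRep k n σ) t = _
  congr 1
  ext1
  ext w
  change coordFun (σ ∘ x) (wTensorRep k n σ (⨂ₜ[ℂ] l, w l)) = coordFun x (⨂ₜ[ℂ] l, w l)
  change coordFun (σ ∘ x) (PiTensorProduct.map (fun _ => wRep n σ) _) = coordFun x _
  rw [PiTensorProduct.map_tprod, coordFun_tprod, coordFun_tprod]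
  refine Finset.prod_congr rfl fun l _ => ?_
  change (w l : Fin n → ℂ) (σ⁻¹ (σ (x l))) = _
  simp

theorem wTensorRep_mul_rankOne (σ : Equiv.Perm (Fin n)) (x : Fin k ⊕ Fin k → Fin n) :
    wTensorRep k n σ * rankOne x = rankOne (σ ∘ x) * wTensorRep k n σ := by
  ext1
  ext w
  simp only [LinearMap.compMultilinearMap_apply, Module.End.mul_apply, rankOne_apply, map_smul,
    wTensorRep_tensorVec]
  congr 1
  exact (coordFun_wTensorRep σ (fun l => x (Sum.inr l)) _).symm

theorem bar_mem_QP (d : Diagram k) : bar n d ∈ QP k n := by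
  classical
  rw [QP, Subalgebra.mem_centralizer_iff]
  rintro _ ⟨σ, rfl⟩
  rw [bar_eq_sum, Finset.mul_sum, Finset.sum_mul,
    ← Equiv.sum_comp ((Equiv.refl (Fin k ⊕ Fin k)).arrowCongr σ) fun x => ite _ _ _ * _]
  refine Finset.sum_congr rfl fun x _ => ?_
  have : (Equiv.refl (Fin k ⊕ Fin k)).arrowCongr σ x = σ ∘ x := rfl
  rw [this, show Setoid.ker (σ ∘ x) = Setoid.ker x from Setoid.ext fun a b => by
    simp [Setoid.ker_def]]
  split_ifs
  · exact wTensorRep_mul_rankOne σ x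
  · simp

theorem eq_sum_rankOne (X : Module.End ℂ (WTensor k n)) :
    X = ∑ x : Fin k ⊕ Fin k → Fin n, coordFun (fun l => x (Sum.inl l))
      (X (tensorVec fun l => x (Sum.inr l))) • rankOne x := by
  rw [← Equiv.sum_comp (Equiv.sumArrowEquivProdArrow (Fin k) (Fin k) (Fin n)).symm,
    Fintype.sum_prod_type]
  conv_lhs => rw [← one_mul X, ← mul_one X, ← sum_rankOne_diag, Finset.sum_mul]
  refine Finset.sum_congr rfl fun i _ => ?_
  rw [Finset.mul_sum, Finset.mul_sum]
  refine Finset.sum_congr rfl fun j _ => ?_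
  ext1
  ext w
  change coordFun i (X (coordFun j _ • tensorVec j)) • tensorVec i =
    coordFun i (X (tensorVec j)) • coordFun j _ • tensorVec i
  rw [map_smul, map_smul, smul_eq_mul, smul_smul, mul_comm]

/-- Equal kernels give a bijection between the ranges, which extends to a permutation of the finite
label set. Thus kernels classify the S_n-orbits of labellings. -/
theorem exists_perm_comp_eq {V : Type*} {x y : V → Fin n} (h : Setoid.ker x = Setoid.ker y) :
    ∃ σ : Equiv.Perm (Fin n), y = σ ∘ x := by
  let e : {a // a ∈ Set.range x} ≃ {a // a ∈ Set.range y} :=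
    (Setoid.quotientKerEquivRange x).symm.trans
      ((Quotient.congrRight fun a b => by rw [h]).trans (Setoid.quotientKerEquivRange y))
  classical
  refine ⟨e.extendSubtype, ?_⟩
  ext v : 1
  rw [comp_apply, e.extendSubtype_apply_of_mem _ ⟨v, rfl⟩]
  have h1 : (Setoid.quotientKerEquivRange x).symm ⟨x v, v, rfl⟩ = Quotient.mk'' v := by
    rw [Equiv.symm_apply_eq]
    rfl
  change y v = (Setoid.quotientKerEquivRange y
    (Quotient.congrRight _ ((Setoid.quotientKerEquivRange x).symm ⟨x v, v, rfl⟩))).1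
  rw [h1]
  rfl

/-- A subspace containing all `bar n d` contains the whole centralizer algebra. -/
theorem mem_of_forall_bar_mem {Q : Submodule ℂ (Module.End ℂ (WTensor k n))}
    (hQ : ∀ d : Diagram k, bar n d ∈ Q) {X : Module.End ℂ (WTensor k n)} (hX : X ∈ QP k n) :
    X ∈ Q := by
  classical
  have : Finite (Diagram k) := Finite.of_injective (fun d : Diagram k => d.r) fun a b h =>
    Setoid.ext fun x y => by rw [show a x y = b x y from congrFun (congrFun h x) y]
  have := Fintype.ofFinite (Diagram k)
  let orb : Diagram k → Module.End ℂ (WTensor k n) := fun d =>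
    ∑ x : Fin k ⊕ Fin k → Fin n, if d = Setoid.ker x then rankOne x else 0
  have h1 : ∀ d, orb d ∈ Q := by
    intro d
    induction d using WellFoundedGT.induction with
    | ind d ih =>
      -- Sorting labellings by kernel makes the passage from orbit sums to `bar` unitriangular; the
      -- induction inverts it, starting from the coarsest diagram.
      have h2 : bar n d = orb d + ∑ d', if d < d' then orb d' else 0 := by
        rw [bar_eq_sum]
        simp only [orb]
        have h3 : ∀ d' : Diagram k, (if d < d' then ∑ x : Fin k ⊕ Fin k → Fin n,
            if d' = Setoid.ker x then rankOne x else 0 else 0) = ∑ x : Fin k ⊕ Fin k → Fin n,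
              if d' = Setoid.ker x then if d < d' then rankOne x else 0 else 0 := fun d' => by
          split_ifs <;> simp
        simp only [h3]
        rw [Finset.sum_comm, ← Finset.sum_add_distrib]
        refine Finset.sum_congr rfl fun x _ => ?_
        rw [Finset.sum_ite_eq_of_mem' _ _ _ (Finset.mem_univ _)]
        rcases eq_or_ne d (Setoid.ker x) with h | h
        · simp [← h]
        · simp [h, lt_iff_le_and_ne]
      rw [← add_sub_cancel_right (orb d) (∑ d', if d < d' then orb d' else 0), ← h2]
      refine Q.sub_mem (hQ d) (Q.sum_mem fun d' _ => ?_)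
      split_ifs with h
      · exact ih d' h
      · exact Q.zero_mem
  rw [QP, Subalgebra.mem_centralizer_iff] at hX
  let m : (Fin k ⊕ Fin k → Fin n) → ℂ := fun x =>
    coordFun (fun l => x (Sum.inl l)) (X (tensorVec fun l => x (Sum.inr l)))
  have hm : ∀ x y, Setoid.ker x = Setoid.ker y → m x = m y := by
    intro x y h
    obtain ⟨σ, rfl⟩ := exists_perm_comp_eq h
    have h3 := LinearMap.congr_fun (hX _ ⟨σ, rfl⟩) (tensorVec fun l => x (Sum.inr l))
    rw [Module.End.mul_apply, Module.End.mul_apply, wTensorRep_tensorVec] at h3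
    change m x = coordFun (σ ∘ fun l => x (Sum.inl l))
      (X (tensorVec (σ ∘ fun l => x (Sum.inr l))))
    rw [← h3, coordFun_wTensorRep]
  -- The default `0` is harmless: if no labelling has kernel `d`, then `orb d` is an empty sum.
  -- Linear independence of the `rankOne x` is not needed.
  have h4 : X = ∑ d : Diagram k, (if h : ∃ x, Setoid.ker x = d then m h.choose else 0) • orb d := by
    rw [eq_sum_rankOne X]
    simp only [orb, Finset.smul_sum]
    rw [Finset.sum_comm]
    refine Finset.sum_congr rfl fun x _ => ?_
    rw [Finset.sum_eq_single (Setoid.ker x)]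
    · have hx : ∃ y : Fin k ⊕ Fin k → Fin n, Setoid.ker y = Setoid.ker x := ⟨x, rfl⟩
      rw [if_pos rfl, dif_pos hx, hm _ _ hx.choose_spec]
    · intro d _ hd
      rw [if_neg hd, smul_zero]
    · simp
  rw [h4]
  exact Q.sum_mem fun d _ => Q.smul_mem _ (h1 d)

end RankOne

/-! ## Label sums and diagrams -/

section LabelSum

variable {k n : ℕ} {L : Type*} [Fintype L] [DecidableEq L]

/-- A vertex labelling constant on the blocks determines `φ` on the image of `f`; each unused label
contributes a free factor `n`. -/
theorem labelSum_rankOne_eq (f : Fin k ⊕ Fin k → L) :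
    ∃ N : ℕ, labelSum rankOne f = (n : ℂ) ^ N • bar n (Setoid.ker f) := by
  classical
  refine ⟨((Finset.univ.image f)ᶜ).card, ?_⟩
  rw [bar_eq_sum, labelSum, Finset.smul_sum]
  have h : ∀ x : Fin k ⊕ Fin k → Fin n,
      ((Finset.univ.filter fun φ : L → Fin n => φ ∘ f = x).card : ℂ) =
        if Setoid.ker f ≤ Setoid.ker x then (n : ℂ) ^ ((Finset.univ.image f)ᶜ).card else 0 := by
    intro x
    split_ifs with hx
    · have h1 : (Finset.univ.filter fun φ : L → Fin n => φ ∘ f = x) = Fintype.piFinset fun l =>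
          if h : ∃ v, f v = l then {x h.choose} else Finset.univ := by
        ext φ
        simp only [Finset.mem_filter, Finset.mem_univ, true_and, Fintype.mem_piFinset]
        constructor
        · rintro rfl l
          split_ifs with hl
          · rw [Finset.mem_singleton, comp_apply, hl.choose_spec]
          · exact Finset.mem_univ _
        · intro h
          ext v : 1
          have hv : ∃ w, f w = f v := ⟨v, rfl⟩
          have h2 := h (f v)
          rw [dif_pos hv, Finset.mem_singleton] at h2
          exact h2.trans (hx hv.choose_spec)
      rw [h1, Fintype.card_piFinset, Nat.cast_prod]
      have h3 : ∀ l, ((if h : ∃ v, f v = l then {x h.choose} else Finset.univ : Finset (Fin n)).card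
          : ℂ) = if l ∈ Finset.univ.image f then 1 else (n : ℂ) := by
        intro l
        by_cases hl : ∃ v, f v = l <;> simp [hl]
      simp only [h3]
      rw [Finset.prod_ite]
      simp only [Finset.prod_const_one, Finset.prod_const, one_mul]
      congr 2
      ext l
      simp
    · rw [Nat.cast_eq_zero, Finset.card_eq_zero, Finset.filter_eq_empty_iff]
      rintro φ - rfl
      exact hx fun {a b} (hab : f a = f b) => congrArg φ hab
  rw [← Finset.sum_fiberwise (s := Finset.univ) (g := fun φ : L → Fin n => φ ∘ f)]
  refine Finset.sum_congr rfl fun x _ => ?_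
  rw [Finset.sum_congr rfl (g := fun _ => rankOne x)
    (fun φ hφ => by rw [(Finset.mem_filter.mp hφ).2]), Finset.sum_const,
    ← Nat.cast_smul_eq_nsmul ℂ, h]
  split_ifs <;> simp

theorem labelSum_mem_iff [NeZero n] {Q : Submodule ℂ (Module.End ℂ (WTensor k n))}
    {f : Fin k ⊕ Fin k → L} : labelSum rankOne f ∈ Q ↔ bar n (Setoid.ker f) ∈ Q := by
  obtain ⟨N, hN⟩ := labelSum_rankOne_eq (n := n) f
  rw [hN]
  exact Q.smul_mem_iff (pow_ne_zero _ (NeZero.ne _))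

end LabelSum

/-! ## The action of the generators on rank one operators -/

section LocalSums

variable {k n : ℕ} [NeZero n] {M : Type*} [AddCommGroup M] [Module ℂ M]
  {F : (Fin k → Fin n) → M}

/-- Off `T` the diagram consists of vertical strands. There `F` sums to zero along each label, so
`κ` turns into `δ` and only the positions in `T` remain to be summed. -/
theorem sum_kappa_local (hF : Killed F) (z : Fin k → Fin n) (T : Finset (Fin k))
    {a b : Fin k → Fin k} (ha : ∀ l ∉ T, a l = l) (haT : ∀ l ∈ T, a l ∈ T)
    (hb : ∀ l ∉ T, b l = l) (hbT : ∀ l ∈ T, b l ∈ T) :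
    ∑ φ : Fin k → Fin n, (∏ l, kappa (φ (b l)) (z l)) • F (φ ∘ a) =
      ∑ φ : Fin k → Fin n, (∏ l ∈ Tᶜ, if φ l = z l then (1 : ℂ) else 0) •
        (∏ l ∈ T, kappa (φ (b l)) (z l)) • F (φ ∘ a) := by
  rw [← sum_prod_kappa_smul Tᶜ z]
  · refine Finset.sum_congr rfl fun φ _ => ?_
    rw [← Finset.prod_compl_mul_prod T, mul_smul]
    congr 1
    exact Finset.prod_congr rfl fun l hl => by rw [hb l (Finset.mem_compl.mp hl)]
  · intro l hl φ
    rw [Finset.mem_compl] at hl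
    have h1 : ∀ c, ∏ j ∈ T, kappa (update φ l c (b j)) (z j) = ∏ j ∈ T, kappa (φ (b j)) (z j) :=
      fun c => Finset.prod_congr rfl fun j hj => by
        rw [update_of_ne (ne_of_mem_of_not_mem (hbT j hj) hl)]
    have h2 : ∀ c, update φ l c ∘ a = update (φ ∘ a) l c := by
      intro c
      ext j : 1
      by_cases hj : j = l
      · subst hj; simp [ha _ hl]
      · have : a j ≠ l := by
          by_cases hjT : j ∈ T
          · exact ne_of_mem_of_not_mem (haT j hjT) hl
          · rwa [ha j hjT]
        simp [hj, this]
    simp only [h1, h2, ← Finset.smul_sum, hF (φ ∘ a) l, smul_zero]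

theorem sum_kappa_perm (hF : Killed F) (z : Fin k → Fin n) (a : Fin k → Fin k)
    (ha : Injective a) : ∑ φ : Fin k → Fin n, (∏ l, kappa (φ l) (z l)) • F (φ ∘ a) = F (z ∘ a) := by
  have ha' := Finite.surjective_of_injective ha
  rw [← sum_prod_delta_univ z fun φ => F (φ ∘ a), Finset.compl_empty]
  refine sum_prod_kappa_smul _ z _ fun l _ φ => ?_
  obtain ⟨j, rfl⟩ := ha' l
  simp only [update_comp_eq_of_injective _ ha]
  exact hF _ j

/-- The factor `n` comes from the label `q`, which neither row uses. -/
theorem sum_kappa_b (hF : Killed F) (z : Fin k → Fin n) {p q : Fin k} (hpq : p ≠ q) :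
    ∑ φ : Fin k → Fin n, (∏ l, kappa (φ (update id q p l)) (z l)) • F (φ ∘ update id q p) =
      (n : ℂ) • ∑ c, (kappa c (z p) * kappa c (z q)) • F (update (update z p c) q c) := by
  rw [sum_kappa_local hF z (insert p (insert q ∅)), sum_prod_delta_insert, sum_prod_delta_insert,
    sum_prod_delta_univ]
  · have h : ∀ d c, update (update z q d) p c ∘ update id q p = update (update z p c) q c := by
      intro d c
      ext j : 1
      simp only [comp_apply, update_apply]
      grind
    simp [h, hpq, Finset.prod_insert, Nat.cast_smul_eq_nsmul]
  all_goals try simp only [update_apply]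
  all_goals grind

/-- Both labels occur, `p` on top and `q` below, so there is no factor `n`. Summing over label `q`
collapses two `κ` to one because `κ` is the matrix of a projection. -/
theorem sum_kappa_e (hF : Killed F) (z : Fin k → Fin n) {p q : Fin k} (hpq : p ≠ q) :
    ∑ φ : Fin k → Fin n, (∏ l, kappa (φ (update id p q l)) (z l)) • F (φ ∘ update id q p) =
      kappa (z p) (z q) • ∑ c, F (update (update z p c) q c) := by
  rw [sum_kappa_local hF z (insert p (insert q ∅)), sum_prod_delta_insert, sum_prod_delta_insert,
    sum_prod_delta_univ]
  · have h : ∀ d c, update (update z q d) p c ∘ update id q p = update (update z p c) q c := by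
      intro d c
      ext j : 1
      simp only [comp_apply, update_apply]
      grind
    rw [← sum_kappa_mul_kappa (z p) (z q)]
    simp [h, hpq, hpq.symm, Finset.prod_insert, ← Finset.smul_sum, ← Finset.sum_smul]
  all_goals try simp only [update_apply]
  all_goals grind

theorem sum_kappa_t (hF : Killed F) (z : Fin k → Fin n) {p q r : Fin k} (hpq : p ≠ q)
    (hpr : p ≠ r) (hqr : q ≠ r) :
    ∑ φ : Fin k → Fin n, (∏ l, kappa (φ (update id q r l)) (z l)) • F (φ ∘ update id q p) =
      (n : ℂ) • ∑ y, ∑ t, (kappa y (z p) * (kappa t (z q) * kappa t (z r))) •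
        F (update (update (update z p y) q y) r t) := by
  rw [sum_kappa_local hF z (insert p (insert r (insert q ∅))), sum_prod_delta_insert,
    sum_prod_delta_insert, sum_prod_delta_insert, sum_prod_delta_univ]
  · have h : ∀ d t c, update (update (update z q d) r t) p c ∘ update id q p =
        update (update (update z p c) q c) r t := by
      intro d t c
      ext j : 1
      simp only [comp_apply, update_apply]
      grind
    simp [h, hpq, hpr, hpr.symm, hqr.symm, Finset.prod_insert,
      Nat.cast_smul_eq_nsmul]
    rw [Finset.sum_comm]
    simp only [mul_comm]
  all_goals try simp only [update_apply]
  all_goals grind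

theorem sum_kappa_h (hF : Killed F) (z : Fin k → Fin n) {p q r : Fin k} (hpq : p ≠ q)
    (hpr : p ≠ r) (hqr : q ≠ r) :
    ∑ φ : Fin k → Fin n, (∏ l, kappa (φ (update (update id p q) r q l)) (z l)) •
        F (φ ∘ update (update id q p) r p) =
      (n : ℂ) • ∑ y, (kappa y (z p) * (kappa y (z q) * kappa y (z r))) •
        ∑ t, F (update (update (update z p t) q t) r t) := by
  rw [sum_kappa_local hF z (insert p (insert q (insert r ∅))), sum_prod_delta_insert,
    sum_prod_delta_insert, sum_prod_delta_insert, sum_prod_delta_univ]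
  · have h : ∀ d t c, update (update (update z r d) q t) p c ∘ update (update id q p) r p =
        update (update (update z p c) q c) r c := by
      intro d t c
      ext j : 1
      simp only [comp_apply, update_apply]
      grind
    simp [h, hpq, hpq.symm, hpr, hqr, Finset.prod_insert, ← Finset.smul_sum,
      Nat.cast_smul_eq_nsmul]
  all_goals try simp only [update_apply]
  all_goals grind

end LocalSums

/-! ### Multiplication of rank one operators by labelled diagrams -/

section Ops

variable {k n : ℕ}

/-- The operator, up to a scalar, of the diagram with top labels `a` and bottom labels `b`. -/
def labelOp (n : ℕ) (a b : Fin k → Fin k) : Module.End ℂ (WTensor k n) :=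
  labelSum rankOne (Sum.elim a b)

theorem killed_top (y : Fin k → Fin n) : Killed fun t => rankOne (Sum.elim t y) := by
  intro t v
  simp only [← Sum.update_elim_inl]
  exact killed_rankOne _ _

theorem killed_bot (y : Fin k → Fin n) : Killed fun t => rankOne (Sum.elim y t) := by
  intro t v
  simp only [← Sum.update_elim_inr]
  exact killed_rankOne _ _

theorem labelOp_mul_rankOne (a b : Fin k → Fin k) (x : Fin k ⊕ Fin k → Fin n) :
    labelOp n a b * rankOne x = ∑ φ : Fin k → Fin n,
      (∏ l, kappa (φ (b l)) (x (Sum.inl l))) • rankOne (Sum.elim (φ ∘ a) (x ∘ Sum.inr)) := by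
  rw [labelOp, labelSum, Finset.sum_mul]
  exact Finset.sum_congr rfl fun φ _ => rankOne_mul _ _

theorem rankOne_mul_labelOp (a b : Fin k → Fin k) (x : Fin k ⊕ Fin k → Fin n) :
    rankOne x * labelOp n a b = ∑ φ : Fin k → Fin n,
      (∏ l, kappa (φ (a l)) (x (Sum.inr l))) • rankOne (Sum.elim (x ∘ Sum.inl) (φ ∘ b)) := by
  rw [labelOp, labelSum, Finset.mul_sum]
  refine Finset.sum_congr rfl fun φ _ => ?_
  rw [rankOne_mul]
  simp only [kappa_comm (x _)]
  rfl

theorem labelOp_perm_mul_labelSum [NeZero n] {L : Type*} [Fintype L] [DecidableEq L] (σ : Equiv.Perm (Fin k))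
    (f : Fin k ⊕ Fin k → L) : labelOp n σ id * labelSum rankOne f =
      labelSum rankOne (f ∘ Sum.map σ id) := by
  rw [labelSum, Finset.mul_sum]
  refine Finset.sum_congr rfl fun φ _ => ?_
  rw [labelOp_mul_rankOne]
  refine (sum_kappa_perm (killed_top _) (fun l => (φ ∘ f) (Sum.inl l)) σ σ.injective).trans ?_
  congr 1
  ext (v | v) <;> rfl

theorem labelSum_mul_labelOp_perm [NeZero n] {L : Type*} [Fintype L] [DecidableEq L] (σ : Equiv.Perm (Fin k))
    (f : Fin k ⊕ Fin k → L) : labelSum rankOne f * labelOp n id σ =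
      labelSum rankOne (f ∘ Sum.map id σ) := by
  rw [labelSum, Finset.sum_mul]
  refine Finset.sum_congr rfl fun φ _ => ?_
  rw [rankOne_mul_labelOp]
  refine (sum_kappa_perm (killed_bot _) (fun l => (φ ∘ f) (Sum.inr l)) σ σ.injective).trans ?_
  congr 1
  ext (v | v) <;> rfl

theorem labelSum_perm_comp {L : Type*} [Fintype L] [DecidableEq L] (σ : Equiv.Perm L)
    (f : Fin k ⊕ Fin k → L) :
    (labelSum rankOne (σ ∘ f) : Module.End ℂ (WTensor k n)) = labelSum rankOne f := by
  rw [labelSum, labelSum, ← Equiv.sum_comp (σ.arrowCongr (Equiv.refl (Fin n)))]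
  refine Finset.sum_congr rfl fun φ _ => congrArg rankOne ?_
  ext v
  simp

theorem labelOp_one : labelOp n (id : Fin k → Fin k) id = 1 := by
  rw [← sum_rankOne_diag, labelOp, labelSum]
  refine Finset.sum_congr rfl fun φ _ => congrArg rankOne ?_
  ext (v | v) <;> rfl

end Ops

/-! ### Moving the generators to arbitrary positions -/

section Generated

variable {k n : ℕ} [NeZero n] {A : Subalgebra ℂ (Module.End ℂ (WTensor k n))}

theorem labelOp_mem {d : Diagram k} (hd : bar n d ∈ A) {a b : Fin k → Fin k}
    {top bot : ℕ → ℕ} (h : d = Diagram.ofLabels k top bot) (ha : ∀ j : Fin k, (a j : ℕ) = top j)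
    (hb : ∀ j : Fin k, (b j : ℕ) = bot j) : labelOp n a b ∈ A := by
  rw [labelOp, ← Subalgebra.mem_toSubmodule, labelSum_mem_iff, Subalgebra.mem_toSubmodule]
  convert hd
  rw [h]
  ext x y
  rcases x with x | x <;> rcases y with y | y <;>
    simp [Setoid.ker_def, ← ha, ← hb, Fin.ext_iff]

theorem labelOp_perm_mem (hA : ∀ d ∈ generators k, bar n d ∈ A)
    (σ : Equiv.Perm (Fin k)) : labelOp n σ id ∈ A := by
  obtain _ | m := k
  · rw [Subsingleton.elim σ 1]
    change labelOp n id id ∈ A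
    rw [labelOp_one]
    exact A.one_mem
  have h : (⊤ : Submonoid (Equiv.Perm (Fin (m + 1)))) ≤
      { carrier := {σ | labelOp n σ id ∈ A}
        one_mem' := by
          change labelOp n id id ∈ A
          rw [labelOp_one]
          exact A.one_mem
        mul_mem' := fun {σ τ} hσ hτ => by
          -- The assignment `σ ↦ labelOp n σ id` reverses products.
          have h1 := A.mul_mem hτ hσ
          change labelOp n τ id * labelSum rankOne (Sum.elim σ id) ∈ A at h1
          rw [labelOp_perm_mul_labelSum] at h1
          have h2 : Sum.elim σ id ∘ Sum.map τ id = Sum.elim (σ * τ) id := by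
            ext (v | v) <;> rfl
          rwa [h2] at h1 } := by
    rw [← Equiv.Perm.mclosure_swap_castSucc_succ, Submonoid.closure_le]
    rintro _ ⟨i, rfl⟩
    refine labelOp_mem (hA (diagS (m + 1) i) (Or.inl ⟨i, by omega, rfl⟩)) rfl ?_ fun _ => rfl
    intro j
    simp only [Equiv.swap_apply_def, Fin.ext_iff]
    split_ifs <;> simp_all
  exact h (Submonoid.mem_top σ)

theorem labelOp_perm_mem' (hA : ∀ d ∈ generators k, bar n d ∈ A)
    (σ : Equiv.Perm (Fin k)) : labelOp n id σ ∈ A := by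
  have h := labelOp_perm_mem hA σ.symm
  rw [labelOp, ← labelSum_perm_comp σ] at h
  convert h using 2
  rw [labelOp]
  congr 1
  ext (v | v) <;> simp

theorem labelSum_map_mem (hA : ∀ d ∈ generators k, bar n d ∈ A)
    {L : Type*} [Fintype L] [DecidableEq L] {f : Fin k ⊕ Fin k → L}
    (hf : labelSum rankOne f ∈ A) (σ τ : Equiv.Perm (Fin k)) :
    labelSum rankOne (f ∘ Sum.map σ τ) ∈ A := by
  have h := A.mul_mem (A.mul_mem (labelOp_perm_mem hA σ) hf) (labelOp_perm_mem' hA τ)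
  rw [labelOp_perm_mul_labelSum, labelSum_mul_labelOp_perm] at h
  convert h using 2
  ext (v | v) <;> rfl

theorem labelOp_conj_mem (hA : ∀ d ∈ generators k, bar n d ∈ A)
    {a b : Fin k → Fin k} (h : labelOp n a b ∈ A)
    (σ : Equiv.Perm (Fin k)) : labelOp n (σ ∘ a ∘ σ.symm) (σ ∘ b ∘ σ.symm) ∈ A := by
  have h1 := labelSum_map_mem hA h σ.symm σ.symm
  rw [← labelSum_perm_comp σ] at h1
  convert h1 using 2
  rw [labelOp]
  congr 1
  ext (v | v) <;> rfl

theorem conj_update (σ : Equiv.Perm (Fin k)) (f : Fin k → Fin k) (p q : Fin k) :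
    σ ∘ update f p q ∘ σ.symm = update (σ ∘ f ∘ σ.symm) (σ p) (σ q) := by
  ext v : 1
  simp only [comp_apply, update_apply, Equiv.symm_apply_eq]
  grind

theorem conj_id (σ : Equiv.Perm (Fin k)) : σ ∘ id ∘ σ.symm = id := by
  ext v
  simp

theorem exists_perm_zero_one {m : ℕ} {p q : Fin (m + 2)} (hpq : p ≠ q) :
    ∃ σ : Equiv.Perm (Fin (m + 2)), σ 0 = p ∧ σ 1 = q := by
  obtain ⟨σ, hσ⟩ := Equiv.Perm.exists_extending_pair (α := Fin 2) ![0, 1] ![p, q]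
    (by intro i j; fin_cases i <;> fin_cases j <;> simp)
    (by intro i j; fin_cases i <;> fin_cases j <;> simp [hpq, hpq.symm])
  exact ⟨σ, hσ 0, hσ 1⟩

theorem exists_perm_zero_one_two {m : ℕ} {p q r : Fin (m + 3)} (hpq : p ≠ q) (hpr : p ≠ r)
    (hqr : q ≠ r) : ∃ σ : Equiv.Perm (Fin (m + 3)), σ 0 = p ∧ σ 1 = q ∧ σ 2 = r := by
  have h : 2 % (m + 3) = 2 := Nat.mod_eq_of_lt (by omega)
  obtain ⟨σ, hσ⟩ := Equiv.Perm.exists_extending_pair (α := Fin 3) ![0, 1, 2] ![p, q, r]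
    (by intro i j; fin_cases i <;> fin_cases j <;> simp [Fin.ext_iff, h])
    (by
      intro i j
      fin_cases i <;> fin_cases j <;> simp [hpq, hpq.symm, hpr, hpr.symm, hqr, hqr.symm])
  exact ⟨σ, hσ 0, hσ 1, hσ 2⟩

theorem labelOp_b_mem (hA : ∀ d ∈ generators k, bar n d ∈ A)
    {p q : Fin k} (hpq : p ≠ q) :
    labelOp n (update id q p) (update id q p) ∈ A := by
  obtain _ | _ | m := k
  · exact p.elim0
  · omega
  obtain ⟨σ, h0, h1⟩ := exists_perm_zero_one hpq
  have h := labelOp_conj_mem hA (labelOp_mem (a := update id 1 0) (b := update id 1 0)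
    (hA (diagB _ 0) (Or.inr (Or.inl ⟨by omega, Or.inr rfl⟩))) rfl ?_ ?_) σ
  · simpa only [conj_update, conj_id, h0, h1] using h
  all_goals
    intro j
    simp only [update_apply, id, Fin.ext_iff]
    split_ifs <;> simp_all

theorem labelOp_e_mem (hA : ∀ d ∈ generators k, bar n d ∈ A)
    {p q : Fin k} (hpq : p ≠ q) :
    labelOp n (update id q p) (update id p q) ∈ A := by
  obtain _ | _ | m := k
  · exact p.elim0
  · omega
  obtain ⟨σ, h0, h1⟩ := exists_perm_zero_one hpq
  have h := labelOp_conj_mem hA (labelOp_mem (a := update id 1 0) (b := update id 0 1)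
    (hA (diagE _ 0) (Or.inr (Or.inl ⟨by omega, Or.inl rfl⟩))) rfl ?_ ?_) σ
  · simpa only [conj_update, conj_id, h0, h1] using h
  all_goals
    intro j
    simp only [update_apply, id, Fin.ext_iff]
    split_ifs <;> simp_all

theorem labelOp_t_mem (hA : ∀ d ∈ generators k, bar n d ∈ A)
    {p q r : Fin k} (hpq : p ≠ q) (hpr : p ≠ r) (hqr : q ≠ r) :
    labelOp n (update id q p) (update id q r) ∈ A := by
  obtain _ | _ | _ | m := k
  · exact p.elim0
  · omega
  · omega
  obtain ⟨σ, h0, h1, h2⟩ := exists_perm_zero_one_two hpq hpr hqr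
  have h := labelOp_conj_mem hA (labelOp_mem (a := update id 1 0) (b := update id 1 2)
    (hA (diagT _ 0) (Or.inr (Or.inr ⟨by omega, Or.inl rfl⟩))) rfl ?_ ?_) σ
  · simpa only [conj_update, conj_id, h0, h1, h2] using h
  all_goals
    intro j
    simp only [update_apply, id, Fin.ext_iff]
    split_ifs <;> simp_all

theorem labelOp_h_mem (hA : ∀ d ∈ generators k, bar n d ∈ A)
    {p q r : Fin k} (hpq : p ≠ q) (hpr : p ≠ r) (hqr : q ≠ r) :
    labelOp n (update (update id q p) r p) (update (update id p q) r q) ∈ A := by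
  obtain _ | _ | _ | m := k
  · exact p.elim0
  · omega
  · omega
  obtain ⟨σ, h0, h1, h2⟩ := exists_perm_zero_one_two hpq hpr hqr
  have h := labelOp_conj_mem hA (labelOp_mem (a := update (update id 1 0) 2 0)
    (b := update (update id 0 1) 2 1)
    (hA (diagH _ 0) (Or.inr (Or.inr ⟨by omega, Or.inr rfl⟩))) rfl ?_ ?_) σ
  · simpa only [conj_update, conj_id, h0, h1, h2] using h
  all_goals
    have h3 : ((2 : Fin (m + 3)) : ℕ) = 2 := rfl
    intro j
    simp only [update_apply, id, Fin.ext_iff, apply_ite Fin.val, h3, Fin.val_zero, Fin.val_one]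
    split_ifs <;> omega

end Generated

/-! ## Reduction of an arbitrary diagram -/

theorem exists_perm_of_injective {k : ℕ} {L : Type*} {a b : Fin k → L} (ha : Injective a) (h : ∀ j, ∃ i, b i = a j) :
    ∃ σ : Equiv.Perm (Fin k), ∀ j, b (σ j) = a j := by
  choose g hg using h
  have hg' : Injective g := fun i j hij => ha (by rw [← hg, ← hg, hij])
  exact ⟨Equiv.ofBijective g (Finite.injective_iff_bijective.mp hg'), hg⟩

/-! ### Block counts that control the induction -/

section Measure

variable {k : ℕ} {L : Type*} [DecidableEq L]

/-- The number of blocks of a labelled diagram. -/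
def numBlocks (f : Fin k ⊕ Fin k → L) : ℕ := (Finset.univ.image f).card

/-- The number of blocks meeting the top row plus the number of blocks meeting the bottom row. -/
def numSides (f : Fin k ⊕ Fin k → L) : ℕ :=
  (Finset.univ.image fun j => f (Sum.inl j)).card + (Finset.univ.image fun j => f (Sum.inr j)).card

theorem numBlocks_le (f : Fin k ⊕ Fin k → L) : numBlocks f ≤ 2 * k := by
  refine Finset.card_image_le.trans ?_
  simp [two_mul]

theorem numSides_le (f : Fin k ⊕ Fin k → L) : numSides f ≤ 2 * k := by
  have h1 : (Finset.univ.image fun j => f (Sum.inl j)).card ≤ k := by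
    simpa using (Finset.card_image_le (s := Finset.univ) (f := fun j : Fin k => f (Sum.inl j)))
  have h2 : (Finset.univ.image fun j => f (Sum.inr j)).card ≤ k := by
    simpa using (Finset.card_image_le (s := Finset.univ) (f := fun j : Fin k => f (Sum.inr j)))
  rw [numSides]
  omega

theorem card_image_le_of {ι κ : Type*} [Fintype ι] [Fintype κ] {f : ι → L} {g : κ → L}
    (h : ∀ x, ∃ y, g y = f x) : (Finset.univ.image f).card ≤ (Finset.univ.image g).card := by
  refine Finset.card_le_card fun l hl => ?_
  obtain ⟨x, -, rfl⟩ := Finset.mem_image.mp hl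
  obtain ⟨y, hy⟩ := h x
  exact Finset.mem_image.mpr ⟨y, Finset.mem_univ _, hy⟩

theorem card_image_lt_of {ι κ : Type*} [Fintype ι] [Fintype κ] {f : ι → L} {g : κ → L} {o : L}
    (h : ∀ x, ∃ y, g y = f x) (ho : ∀ x, f x ≠ o) (hg : ∃ y, g y = o) :
    (Finset.univ.image f).card < (Finset.univ.image g).card := by
  refine Finset.card_lt_card ((Finset.ssubset_iff_of_subset fun l hl => ?_).mpr ⟨o, ?_, ?_⟩)
  · obtain ⟨x, -, rfl⟩ := Finset.mem_image.mp hl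
    obtain ⟨y, hy⟩ := h x
    exact Finset.mem_image.mpr ⟨y, Finset.mem_univ _, hy⟩
  · obtain ⟨y, hy⟩ := hg
    exact Finset.mem_image.mpr ⟨y, Finset.mem_univ _, hy⟩
  · intro hl
    obtain ⟨x, -, hx⟩ := Finset.mem_image.mp hl
    exact ho x hx

theorem numBlocks_lt {f g : Fin k ⊕ Fin k → L} {o : L} (ho : ∀ x, f x ≠ o)
    (h : ∀ x, ∃ y, g y = f x) (hg : ∃ y, g y = o) : numBlocks f < numBlocks g :=
  card_image_lt_of h ho hg

theorem numBlocks_le_update {f : Fin k ⊕ Fin k → L} {p q u : Fin k ⊕ Fin k}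
    (hpq : p ≠ q) (hup : u ≠ p) (hq : f q = f p) :
    numBlocks f ≤ numBlocks (update (update f u (f p)) q (f u)) := by
  refine card_image_le_of fun x => ?_
  by_cases hx : f x = f p
  · exact ⟨p, by simp [hpq, hup.symm, hx]⟩
  · by_cases hx' : f x = f u
    · exact ⟨q, by simp [hx']⟩
    · refine ⟨x, ?_⟩
      simp only [update_apply]
      grind

/-- The block `{p, q}` did not meet the bottom row; now `u` carries its label there. Nothing is
lost, since `p` and `v` keep their labels. -/
theorem numSides_lt_inl {f : Fin k ⊕ Fin k → L} {p q u v : Fin k} (hpq : p ≠ q) (huv : u ≠ v)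
    (hq : f (Sum.inl q) = f (Sum.inl p)) (hv : f (Sum.inr v) = f (Sum.inr u))
    (ha : ∀ x, f x = f (Sum.inl p) → x = Sum.inl p ∨ x = Sum.inl q) :
    numSides f < numSides
      (update (update f (Sum.inr u) (f (Sum.inl p))) (Sum.inl q) (f (Sum.inr u))) := by
  refine Nat.add_lt_add_of_le_of_lt (card_image_le_of fun x => ?_)
    (card_image_lt_of (o := f (Sum.inl p)) (fun x => ?_) (fun x hx => ?_) ⟨u, by simp⟩)
  · by_cases hx : x = q
    · exact ⟨p, by simp [hpq, hx, hq]⟩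
    · exact ⟨x, by simp [hx]⟩
  · by_cases hx : x = u
    · exact ⟨v, by simp [huv.symm, hx, hv]⟩
    · exact ⟨x, by simp [hx]⟩
  · simpa using ha _ hx

theorem numSides_lt_inr {f : Fin k ⊕ Fin k → L} {p q u v : Fin k} (hpq : p ≠ q) (huv : u ≠ v)
    (hq : f (Sum.inr q) = f (Sum.inr p)) (hv : f (Sum.inl v) = f (Sum.inl u))
    (ha : ∀ x, f x = f (Sum.inr p) → x = Sum.inr p ∨ x = Sum.inr q) :
    numSides f < numSides
      (update (update f (Sum.inl u) (f (Sum.inr p))) (Sum.inr q) (f (Sum.inl u))) := by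
  refine Nat.add_lt_add_of_lt_of_le
    (card_image_lt_of (o := f (Sum.inr p)) (fun x => ?_) (fun x hx => ?_) ⟨u, by simp⟩)
    (card_image_le_of fun x => ?_)
  · by_cases hx : x = u
    · exact ⟨v, by simp [huv.symm, hx, hv]⟩
    · exact ⟨x, by simp [hx]⟩
  · simpa using ha _ hx
  · by_cases hx : x = q
    · exact ⟨p, by simp [hpq, hx, hq]⟩
    · exact ⟨x, by simp [hx]⟩

theorem exists_two_fresh [Fintype L] (hL : 2 * k + 2 ≤ Fintype.card L) (f : Fin k ⊕ Fin k → L) :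
    ∃ o o' : L, (∀ x, f x ≠ o) ∧ (∀ x, f x ≠ o') ∧ o ≠ o' := by
  have h := Finset.card_compl (Finset.univ.image f)
  have h1 := numBlocks_le f
  rw [numBlocks] at h1
  obtain ⟨o, ho, o', ho', hoo⟩ := Finset.one_lt_card.mp
    (show 1 < (Finset.univ.image f)ᶜ.card by omega)
  simp only [Finset.mem_compl, Finset.mem_image, Finset.mem_univ, true_and, not_exists] at ho ho'
  exact ⟨o, o', ho, ho', hoo⟩

end Measure

/-! ### Induction over diagrams -/

section Reduction

variable {k n : ℕ} [NeZero n] {L M : Type*} [Fintype L] [DecidableEq L] [AddCommGroup M]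
  [Module ℂ M] {Q : Submodule ℂ M} {E : (Fin k ⊕ Fin k → Fin n) → M}

theorem labelSum_mem_of_stable (hL : 2 * k + 2 ≤ Fintype.card L) (hE : Killed E)
    (hSB : ∀ p q, p ≠ q → p.isLeft = q.isLeft → StableB Q E p q)
    (hSE : ∀ p q, p ≠ q → p.isLeft = q.isLeft → StableE Q E p q)
    (hST : ∀ p q r, p ≠ q → p ≠ r → q ≠ r → p.isLeft = q.isLeft → p.isLeft = r.isLeft →
      StableT Q E p q r)
    (hSH : ∀ p q r, p ≠ q → p ≠ r → q ≠ r → p.isLeft = q.isLeft → p.isLeft = r.isLeft →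
      StableH Q E p q r)
    (hperm : ∀ (f : Fin k ⊕ Fin k → L) (σ : Equiv.Perm (Fin k)),
      Injective (fun j => f (Sum.inl j)) → (∀ j, f (Sum.inl (σ j)) = f (Sum.inr j)) →
        labelSum E f ∈ Q) (f : Fin k ⊕ Fin k → L) : labelSum E f ∈ Q := by
  -- Lexicographic order on (`numBlocks`, `numSides`) packed into one number: the weight `2 * k + 1`
  -- exceeds every value of `numSides`.
  induction hN : (2 * k * (2 * k + 1) + 2 * k) - (numBlocks f * (2 * k + 1) + numSides f) using
    Nat.strong_induction_on generalizing f with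
  | _ N ih =>
  have bd : ∀ g : Fin k ⊕ Fin k → L, numBlocks g * (2 * k + 1) + numSides g ≤
      2 * k * (2 * k + 1) + 2 * k := fun g =>
    Nat.add_le_add (Nat.mul_le_mul_right _ (numBlocks_le g)) (numSides_le g)
  have ihb : ∀ g : Fin k ⊕ Fin k → L, numBlocks f < numBlocks g → labelSum E g ∈ Q := by
    intro g hg
    refine ih _ ?_ g rfl
    have h1 := bd g
    have h2 := numSides_le f
    have h3 := Nat.mul_le_mul_right (2 * k + 1) hg
    rw [Nat.succ_mul] at h3
    omega
  have ihs : ∀ g : Fin k ⊕ Fin k → L, numBlocks f ≤ numBlocks g → numSides f < numSides g →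
      labelSum E g ∈ Q := by
    intro g hg hg'
    refine ih _ ?_ g rfl
    have h1 := bd g
    have h3 := Nat.mul_le_mul_right (2 * k + 1) hg
    omega
  clear ih bd
  obtain ⟨o, o', ho, ho', hoo⟩ := exists_two_fresh hL f
  by_cases hs : ∃ v, ∀ w, f w = f v → w = v
  · obtain ⟨v, hv⟩ := hs
    rw [labelSum_eq_zero hE hv]
    exact Q.zero_mem
  push Not at hs
  -- The fourth vertex `v` keeps the old block nonempty in the corrections that move `p, q, w` away,
  -- so these really have more blocks.
  by_cases hbig : ∃ p q w v, p ≠ q ∧ p.isLeft = q.isLeft ∧ p ≠ w ∧ q ≠ w ∧ p ≠ v ∧ q ≠ v ∧ w ≠ v ∧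
      f q = f p ∧ f w = f p ∧ f v = f p
  · obtain ⟨p, q, w, v, hpq, hlr, hpw, hqw, hpv, hqv, hwv, hq, hw, hv⟩ := hbig
    clear ihs hs hperm hSE hST hSH hN
    refine labelSum_mem_of_stableB (hSB p q hpq hlr) rfl hq hw hpq hpw hqw ho ho' hoo
      (ihb _ (numBlocks_lt ho (fun x => ?_) ⟨w, ?_⟩)) (ihb _ (numBlocks_lt ho (fun x => ?_) ⟨w, ?_⟩))
      (ihb _ (numBlocks_lt ho (fun x => ?_) ⟨w, ?_⟩)) (ihb _ (numBlocks_lt ho (fun x => ?_) ⟨w, ?_⟩))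
    all_goals simp only [update_apply]
    · by_cases hx : f x = f p
      · exact ⟨p, by grind⟩
      · exact ⟨x, by grind⟩
    · grind
    · by_cases hx : f x = f p
      · exact ⟨p, by grind⟩
      · exact ⟨x, by grind⟩
    · grind
    · by_cases hx : f x = f p
      · exact ⟨v, by grind⟩
      · exact ⟨x, by grind⟩
    · grind
    · by_cases hx : f x = f p
      · exact ⟨v, by grind⟩
      · exact ⟨x, by grind⟩
    · grind
  have hbig' : ∀ p q w v, p ≠ q → p.isLeft = q.isLeft → p ≠ w → q ≠ w → p ≠ v → q ≠ v →
      f q = f p → f w = f p → f v = f p → v = w := by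
    intro p q w v h1 h2 h3 h4 h5 h6 h7 h8 h9
    by_contra h
    exact hbig ⟨p, q, w, v, h1, h2, h3, h4, h5, h6, Ne.symm h, h7, h8, h9⟩
  clear hbig
  -- If no two top vertices share a block, the absence of singletons joins each of them to a bottom
  -- vertex; counting makes this a permutation.
  by_cases hl : Injective fun j => f (Sum.inl j)
  · obtain ⟨σ, hσ⟩ := exists_perm_of_injective (b := fun j => f (Sum.inr j)) hl fun j => by
      obtain ⟨w | w, hw, hne⟩ := hs (Sum.inl j)
      · exact (hne (congrArg Sum.inl (hl hw))).elim
      · exact ⟨w, hw⟩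
    refine hperm f σ.symm hl fun j => ?_
    have := hσ (σ.symm j)
    simpa using this.symm
  by_cases hr : Injective fun j => f (Sum.inr j)
  · obtain ⟨σ, hσ⟩ := exists_perm_of_injective (b := fun j => f (Sum.inl j)) hr fun j => by
      obtain ⟨w | w, hw, hne⟩ := hs (Sum.inr j)
      · exact ⟨w, hw⟩
      · exact (hne (congrArg Sum.inr (hr hw))).elim
    refine (hl fun i j hij => ?_).elim
    have h1 := hσ (σ.symm i)
    have h2 := hσ (σ.symm j)
    simp only [Equiv.apply_symm_apply] at h1 h2
    exact σ.symm.injective (hr (by simp only [← h1, ← h2]; exact hij))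
  simp only [Injective, not_forall] at hl hr
  obtain ⟨q, p, hq, hqp⟩ := hl
  obtain ⟨v, u, hv, hvu⟩ := hr
  have hpq : p ≠ q := Ne.symm hqp
  have huv : u ≠ v := Ne.symm hvu
  have hac : f (Sum.inl p) ≠ f (Sum.inr u) := by
    intro h
    have := hbig' (Sum.inl p) (Sum.inl q) (Sum.inr u) (Sum.inr v) (by simpa using hpq) rfl
      (by simp) (by simp) (by simp) (by simp) hq h.symm (hv.trans h.symm)
    exact hvu (Sum.inr_injective this)
  -- For a horizontal pair, e does not increase the number of blocks; this is where `numSides` must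
  -- decrease the measure.
  by_cases ha : ∀ x, f x = f (Sum.inl p) → x = Sum.inl p ∨ x = Sum.inl q
  · exact labelSum_mem_of_stableE hE (hSE (Sum.inl p) (Sum.inl q) (by simpa using hpq) rfl)
      rfl hq rfl (by simpa using hpq) hac ha
      (ihs _ (numBlocks_le_update (by simpa using hpq) (by simp) hq)
        (numSides_lt_inl hpq huv hq hv ha))
  by_cases hc : ∀ x, f x = f (Sum.inr u) → x = Sum.inr u ∨ x = Sum.inr v
  · exact labelSum_mem_of_stableE hE (hSE (Sum.inr u) (Sum.inr v) (by simpa using huv) rfl)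
      rfl hv rfl (by simpa using huv) hac.symm hc
      (ihs _ (numBlocks_le_update (by simpa using huv) (by simp) hv)
        (numSides_lt_inr huv hpq hv hq hc))
  push Not at ha hc
  obtain ⟨w, hw, hwp, hwq⟩ := ha
  obtain ⟨t, ht, htu, htv⟩ := hc
  have hP : (Sum.inl p : Fin k ⊕ Fin k) ≠ Sum.inl q := by simpa using hpq
  have hU : (Sum.inr u : Fin k ⊕ Fin k) ≠ Sum.inr v := by simpa using huv
  have ha' : ∀ x, f x = f (Sum.inl p) → x = Sum.inl p ∨ x = Sum.inl q ∨ x = w := by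
    intro x hx
    by_contra! h
    exact h.2.2 (hbig' _ _ w x hP rfl hwp.symm hwq.symm h.1.symm h.2.1.symm hq hw hx)
  have hc' : ∀ x, f x = f (Sum.inr u) → x = Sum.inr u ∨ x = Sum.inr v ∨ x = t := by
    intro x hx
    by_contra! h
    exact h.2.2 (hbig' _ _ t x hU rfl htu.symm htv.symm h.1.symm h.2.1.symm hv ht hx)
  -- Both blocks are now triples. If either third vertex lies in the opposite row, three vertices of
  -- one row meet both blocks and t applies there; otherwise each triple fills one side and h
  -- applies.
  rcases t with r | r
  · refine labelSum_mem_of_stableT hE (hST (Sum.inl p) (Sum.inl q) (Sum.inl r) hP ?_ ?_ rfl rfl)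
      rfl hq hw ht rfl hv hP hwp.symm hwq.symm htu htv hU ha' (fun x hx => ?_) hac ho
      (ihb _ (numBlocks_lt ho (fun x => ?_) ⟨Sum.inr u, by simp⟩))
    · exact fun h => hac ((congrArg f h).trans ht)
    · exact fun h => hac (hq.symm.trans ((congrArg f h).trans ht))
    · rcases hc' x hx with h | h | h <;> simp [h]
    · by_cases hx : f x = f (Sum.inl p)
      · exact ⟨Sum.inl p, by simp [hpq, hx]⟩
      by_cases hx' : f x = f (Sum.inr u)
      · exact ⟨Sum.inr v, by simp [huv.symm, hx', hv]⟩
      · refine ⟨x, ?_⟩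
        simp only [update_apply]
        grind
  rcases w with s | s
  · refine labelSum_mem_of_stableH hE (hSH (Sum.inl p) (Sum.inl q) (Sum.inl s) hP hwp.symm hwq.symm
      rfl rfl) rfl hq hw rfl hv ht hP hwp.symm hwq.symm hU htu.symm htv.symm ha' hc' hac ho
      (ihb _ (numBlocks_lt ho (fun x => ?_) ⟨Sum.inr r, by simp⟩))
    by_cases hx : f x = f (Sum.inl p)
    · refine ⟨Sum.inl p, ?_⟩
      simp only [update_apply]
      grind
    by_cases hx' : f x = f (Sum.inr u)
    · refine ⟨Sum.inl q, ?_⟩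
      simp only [update_apply]
      grind
    · refine ⟨x, ?_⟩
      simp only [update_apply]
      grind
  · refine labelSum_mem_of_stableT hE (hST (Sum.inr u) (Sum.inr v) (Sum.inr s) hU ?_ ?_ rfl rfl)
      rfl hv ht hw rfl hq hU htu.symm htv.symm hwp hwq hP hc' (fun x hx => ?_) hac.symm ho
      (ihb _ (numBlocks_lt ho (fun x => ?_) ⟨Sum.inl p, by simp⟩))
    · exact fun h => hac.symm ((congrArg f h).trans hw)
    · exact fun h => hac.symm (hv.symm.trans ((congrArg f h).trans hw))
    · rcases ha' x hx with h | h | h <;> simp [h]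
    · by_cases hx : f x = f (Sum.inr u)
      · exact ⟨Sum.inr u, by simp [huv, hx]⟩
      by_cases hx' : f x = f (Sum.inl p)
      · exact ⟨Sum.inl q, by simp [hpq.symm, hx', hq]⟩
      · refine ⟨x, ?_⟩
        simp only [update_apply]
        grind

end Reduction

/-! ### Stability of the generated algebra under the local moves -/

section Stability

variable {k n : ℕ} {A : Subalgebra ℂ (Module.End ℂ (WTensor k n))}

theorem exists_mulLeft {a b : Fin k → Fin k} (h : labelOp n a b ∈ A) (c : ℂ) :
    ∃ T : Module.End ℂ (WTensor k n) →ₗ[ℂ] Module.End ℂ (WTensor k n),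
      (∀ m ∈ Subalgebra.toSubmodule A, T m ∈ Subalgebra.toSubmodule A) ∧
      ∀ x, T (rankOne x) = c • ∑ φ : Fin k → Fin n, (∏ l, kappa (φ (b l)) (x (Sum.inl l))) •
        rankOne (Sum.elim (φ ∘ a) (x ∘ Sum.inr)) :=
  ⟨LinearMap.mulLeft ℂ (c • labelOp n a b), fun _ hm => A.mul_mem (A.smul_mem h c) hm, fun x => by
    rw [LinearMap.mulLeft_apply, smul_mul_assoc, labelOp_mul_rankOne]⟩

theorem exists_mulRight {a b : Fin k → Fin k} (h : labelOp n a b ∈ A) (c : ℂ) :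
    ∃ T : Module.End ℂ (WTensor k n) →ₗ[ℂ] Module.End ℂ (WTensor k n),
      (∀ m ∈ Subalgebra.toSubmodule A, T m ∈ Subalgebra.toSubmodule A) ∧
      ∀ x, T (rankOne x) = c • ∑ φ : Fin k → Fin n, (∏ l, kappa (φ (a l)) (x (Sum.inr l))) •
        rankOne (Sum.elim (x ∘ Sum.inl) (φ ∘ b)) :=
  ⟨LinearMap.mulRight ℂ (c • labelOp n a b), fun _ hm => A.mul_mem hm (A.smul_mem h c), fun x => by
    rw [LinearMap.mulRight_apply, mul_smul_comm, rankOne_mul_labelOp]⟩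

theorem elim_update_left {α β γ : Type*} [DecidableEq α] [DecidableEq β] (t : α → γ) (y : β → γ)
    (p : α) (c : γ) : Sum.elim (update t p c) y = update (Sum.elim t y) (Sum.inl p) c :=
  Sum.update_elim_inl.symm

theorem elim_update_right {α β γ : Type*} [DecidableEq α] [DecidableEq β] (t : β → γ) (y : α → γ)
    (p : β) (c : γ) : Sum.elim y (update t p c) = update (Sum.elim y t) (Sum.inr p) c :=
  Sum.update_elim_inr.symm

theorem stableB_of_mem [NeZero n] (hA : ∀ d ∈ generators k, bar n d ∈ A) (p q : Fin k ⊕ Fin k) (hpq : p ≠ q)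
    (hs : p.isLeft = q.isLeft) : StableB (Subalgebra.toSubmodule A) rankOne p q := by
  rcases p with p | p <;> rcases q with q | q <;> simp only [Sum.isLeft_inl, Sum.isLeft_inr,
    Bool.true_eq_false, Bool.false_eq_true] at hs
  · have hpq' : p ≠ q := by simpa using hpq
    obtain ⟨T, hT, h⟩ := exists_mulLeft (labelOp_b_mem hA hpq') ((n : ℂ)⁻¹)
    refine ⟨T, hT, fun x => (h x).trans ((congrArg (((n : ℂ)⁻¹ : ℂ) • ·) (sum_kappa_b
      (killed_top (x ∘ Sum.inr)) (x ∘ Sum.inl) hpq')).trans ?_)⟩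
    simp only [inv_smul_smul₀ (NeZero.ne (n : ℂ)), elim_update_left, Sum.elim_comp_inl_inr, comp_apply]
  · have hpq' : p ≠ q := by simpa using hpq
    obtain ⟨T, hT, h⟩ := exists_mulRight (labelOp_b_mem hA hpq') ((n : ℂ)⁻¹)
    refine ⟨T, hT, fun x => (h x).trans ((congrArg (((n : ℂ)⁻¹ : ℂ) • ·) (sum_kappa_b
      (killed_bot (x ∘ Sum.inl)) (x ∘ Sum.inr) hpq')).trans ?_)⟩
    simp only [inv_smul_smul₀ (NeZero.ne (n : ℂ)), elim_update_right, Sum.elim_comp_inl_inr, comp_apply]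

theorem stableE_of_mem [NeZero n] (hA : ∀ d ∈ generators k, bar n d ∈ A) (p q : Fin k ⊕ Fin k) (hpq : p ≠ q)
    (hs : p.isLeft = q.isLeft) : StableE (Subalgebra.toSubmodule A) rankOne p q := by
  rcases p with p | p <;> rcases q with q | q <;> simp only [Sum.isLeft_inl, Sum.isLeft_inr,
    Bool.true_eq_false, Bool.false_eq_true] at hs
  · have hpq' : p ≠ q := by simpa using hpq
    obtain ⟨T, hT, h⟩ := exists_mulLeft (labelOp_e_mem hA hpq') (1)
    refine ⟨T, hT, fun x => (h x).trans ((congrArg ((1 : ℂ) • ·) (sum_kappa_e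
      (killed_top (x ∘ Sum.inr)) (x ∘ Sum.inl) hpq')).trans ?_)⟩
    simp only [one_smul, elim_update_left, Sum.elim_comp_inl_inr, comp_apply]
  · have hpq' : p ≠ q := by simpa using hpq
    -- Right multiplication reads the diagram upside down, which exchanges the labels `p` and `q`.
    obtain ⟨T, hT, h⟩ := exists_mulRight (labelOp_e_mem hA hpq'.symm) (1)
    refine ⟨T, hT, fun x => (h x).trans ((congrArg ((1 : ℂ) • ·) (sum_kappa_e
      (killed_bot (x ∘ Sum.inl)) (x ∘ Sum.inr) hpq')).trans ?_)⟩
    simp only [one_smul, elim_update_right, Sum.elim_comp_inl_inr, comp_apply]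

theorem stableT_of_mem [NeZero n] (hA : ∀ d ∈ generators k, bar n d ∈ A) (p q r : Fin k ⊕ Fin k)
    (hpq : p ≠ q) (hpr : p ≠ r) (hqr : q ≠ r) (hs : p.isLeft = q.isLeft)
    (hs' : p.isLeft = r.isLeft) : StableT (Subalgebra.toSubmodule A) rankOne p q r := by
  rcases p with p | p <;> rcases q with q | q <;> simp only [Sum.isLeft_inl, Sum.isLeft_inr,
    Bool.true_eq_false, Bool.false_eq_true] at hs <;> rcases r with r | r <;>
    simp only [Sum.isLeft_inl, Sum.isLeft_inr, Bool.true_eq_false, Bool.false_eq_true] at hs'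
  · have hpq' : p ≠ q := by simpa using hpq
    have hpr' : p ≠ r := by simpa using hpr
    have hqr' : q ≠ r := by simpa using hqr
    obtain ⟨T, hT, h⟩ := exists_mulLeft (labelOp_t_mem hA hpq' hpr' hqr') ((n : ℂ)⁻¹)
    refine ⟨T, hT, fun x => (h x).trans ((congrArg ((n : ℂ)⁻¹ • ·) (sum_kappa_t
      (killed_top (x ∘ Sum.inr)) (x ∘ Sum.inl) hpq' hpr' hqr')).trans ?_)⟩
    simp only [inv_smul_smul₀ (NeZero.ne (n : ℂ)), elim_update_left, Sum.elim_comp_inl_inr,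
      comp_apply]
  · have hpq' : p ≠ q := by simpa using hpq
    have hpr' : p ≠ r := by simpa using hpr
    have hqr' : q ≠ r := by simpa using hqr
    -- Upside down, t becomes t with `p` and `r` exchanged, so no further generator is required.
    obtain ⟨T, hT, h⟩ := exists_mulRight (labelOp_t_mem hA hqr'.symm hpr'.symm hpq'.symm) ((n : ℂ)⁻¹)
    refine ⟨T, hT, fun x => (h x).trans ((congrArg ((n : ℂ)⁻¹ • ·) (sum_kappa_t
      (killed_bot (x ∘ Sum.inl)) (x ∘ Sum.inr) hpq' hpr' hqr')).trans ?_)⟩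
    simp only [inv_smul_smul₀ (NeZero.ne (n : ℂ)), elim_update_right, Sum.elim_comp_inl_inr,
      comp_apply]

theorem stableH_of_mem [NeZero n] (hA : ∀ d ∈ generators k, bar n d ∈ A) (p q r : Fin k ⊕ Fin k)
    (hpq : p ≠ q) (hpr : p ≠ r) (hqr : q ≠ r) (hs : p.isLeft = q.isLeft)
    (hs' : p.isLeft = r.isLeft) : StableH (Subalgebra.toSubmodule A) rankOne p q r := by
  rcases p with p | p <;> rcases q with q | q <;> simp only [Sum.isLeft_inl, Sum.isLeft_inr,
    Bool.true_eq_false, Bool.false_eq_true] at hs <;> rcases r with r | r <;>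
    simp only [Sum.isLeft_inl, Sum.isLeft_inr, Bool.true_eq_false, Bool.false_eq_true] at hs'
  · have hpq' : p ≠ q := by simpa using hpq
    have hpr' : p ≠ r := by simpa using hpr
    have hqr' : q ≠ r := by simpa using hqr
    obtain ⟨T, hT, h⟩ := exists_mulLeft (labelOp_h_mem hA hpq' hpr' hqr') ((n : ℂ)⁻¹)
    refine ⟨T, hT, fun x => (h x).trans ((congrArg ((n : ℂ)⁻¹ • ·) (sum_kappa_h
      (killed_top (x ∘ Sum.inr)) (x ∘ Sum.inl) hpq' hpr' hqr')).trans ?_)⟩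
    simp only [inv_smul_smul₀ (NeZero.ne (n : ℂ)), elim_update_left, Sum.elim_comp_inl_inr,
      comp_apply]
  · have hpq' : p ≠ q := by simpa using hpq
    have hpr' : p ≠ r := by simpa using hpr
    have hqr' : q ≠ r := by simpa using hqr
    obtain ⟨T, hT, h⟩ := exists_mulRight (labelOp_h_mem hA hpq'.symm hqr' hpr') ((n : ℂ)⁻¹)
    refine ⟨T, hT, fun x => (h x).trans ((congrArg ((n : ℂ)⁻¹ • ·) (sum_kappa_h
      (killed_bot (x ∘ Sum.inl)) (x ∘ Sum.inr) hpq' hpr' hqr')).trans ?_)⟩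
    simp only [inv_smul_smul₀ (NeZero.ne (n : ℂ)), elim_update_right, Sum.elim_comp_inl_inr,
      comp_apply]

theorem bar_mem_of_generators [NeZero n] (hA : ∀ d ∈ generators k, bar n d ∈ A) (d : Diagram k) :
    bar n d ∈ A := by
  -- Blocks are labelled by representatives; `Fin 2` guarantees the two fresh labels needed at each
  -- reduction step.
  let f : Fin k ⊕ Fin k → (Fin k ⊕ Fin k) ⊕ Fin 2 := fun v => Sum.inl (Quotient.mk d v).out
  have hf : Setoid.ker f = d := by
    ext x y
    rw [Setoid.ker_def]
    simp only [f, Sum.inl.injEq, Quotient.out_inj, Quotient.eq]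
  rw [← Subalgebra.mem_toSubmodule, ← hf, ← labelSum_mem_iff]
  refine labelSum_mem_of_stable (by simp; omega) killed_rankOne (stableB_of_mem hA)
    (stableE_of_mem hA) (stableT_of_mem hA) (stableH_of_mem hA) (fun g σ hg hσ => ?_) f
  have h := labelOp_perm_mem' hA σ
  rw [labelOp, ← Subalgebra.mem_toSubmodule, labelSum_mem_iff] at h
  rw [labelSum_mem_iff]
  convert h using 2
  ext x y
  rw [Setoid.ker_def, Setoid.ker_def, ← hg.eq_iff]
  rcases x with x | x <;> rcases y with y | y <;> simp [hσ]

end Stability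

end QuasiPartition

end

theorem mainTheorem5 (k n : ℕ) (hk : 1 ≤ k) (hn : 2 ≤ n) :
    Algebra.adjoin ℂ {g : Module.End ℂ (QuasiPartition.WTensor k n) |
        ∃ d ∈ QuasiPartition.generators k, g = QuasiPartition.bar n d} =
      QuasiPartition.QP k n := by
  have : NeZero n := ⟨by omega⟩
  refine le_antisymm (Algebra.adjoin_le ?_) fun X hX => ?_
  · rintro _ ⟨d, -, rfl⟩
    exact QuasiPartition.bar_mem_QP d
  · exact QuasiPartition.mem_of_forall_bar_mem (Q := Subalgebra.toSubmodule _)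
      (QuasiPartition.bar_mem_of_generators fun d hd =>
        Algebra.subset_adjoin (show ∃ _, _ from ⟨d, hd, rfl⟩)) hX
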